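/- Conventions. A compact rooted $\mathbb R$-tree $(T,d,\rho)$ is a compact metric space $(T,d)$ with a root $\rho\in T$ in which any two points $a,b$ are joined by an isometric copy of $[0,d(a,b)]$ that is also the range of every injective path from $a$ to $b$. Let $\mathbb T$ be the set of these trees up to root-preserving isometry, with the pointed Gromov–Hausdorff distance $$d_{\rm GH}(T,T')=\inf\max\{\delta(\varphi(\rho),\varphi'(\rho')),\ \delta_{\rm H}(\varphi(T),\varphi'(T'))\},$$ the infimum being over all metric spaces $(M,\delta)$ and isometric embeddings $\varphi:T\to M$, $\varphi':T'\to M$ ($\delta_{\rm H}$ is the Hausdorff distance), and with its Borel $\sigma$-algebra. Put ${\rm ht}(T)=\sup_{x\in T}d(\rho,x)$. For $p\ge1$ let $\mathcal P_p$ be the set of probability measures $\eta$ on $\mathbb T$ with $\int {\rm ht}^p\,d\eta<\infty$, and let $$W_p(\eta,\eta')=\Big(\inf \mathbb E[d_{\rm GH}(\tau,\tau')^p]\Big)^{1/p},$$ the infimum being over all couplings $(\tau,\tau')$ of $\eta$ and $\eta'$. Let $\beta>0$. For a string $\xi=([0,\ell],(x_i)_{i\ge1},(p_i)_{i\ge1})$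 with $0\le x_i\le\ell$ and $p_i\ge0$, and for $\tau_i\in\mathbb T$, $i\ge1$, let $\phi_\beta(\xi,\tau_i,i\ge1)\in\mathbb T$ be the class of the tree obtained from $[0,\ell]$, rooted at $0$, by attaching for each $i$ the tree $\tau_i$ with all distances multiplied by $p_i^\beta$ (a single point if $p_i=0$), its root being identified with $x_i$, if this tree is compact, and the class of the one-point tree otherwise. Theorem (Fixpoint). Let $\beta\in(0,\infty)$ and $p\ge1$, and let $\xi=([0,L],(X_i)_{i\ge1},(P_i)_{i\ge1})$ be a random string with $0\le X_i\le L$ and $P_i\ge0$ for all $i\ge 1$ (the $X_i$ need not be distinct and $\sum_i P_i$ is not restricted), such that $$\mathbb E[L^p]<\infty\qquad\text{and}\qquad \mathbb E\Big[\sum_{j\ge1}P_j^{p\beta}\Big]<1.$$ For $\eta\in\mathcal P_p$ let $\Phi_\beta(\eta)$ be the law of $\phi_\beta(\xi,\mathcal T_i,i\ge1)$, where $\mathcal T_1,\mathcal T_2,\dots$ are i.i.d. with law $\eta$ and independent of $\xi$. Then $\Phi_\beta$ maps $\mathcal P_p$ into $\mathcal P_p$, it has a unique fixpoint $\eta^*\in\mathcal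 P_p$, and $W_p(\Phi_\beta^n(\eta),\eta^*)\to0$ as $n\to\infty$ for every $\eta\in\mathcal P_p$. -/

import Mathlib

open Set MeasureTheory Filter Topology
open scoped ENNReal

namespace RDE

/-- An `ℝ`-tree: any two points `a`, `b` are joined by an isometric copy `h` of `[0, d(a, b)]`,
and every injective path from `a` to `b` has the same range as `h`. -/
def IsRTree (T : Type*) [MetricSpace T] : Prop :=
  ∀ a b : T, ∃ h : ℝ → T,
    (∀ s ∈ Icc 0 (dist a b), ∀ t ∈ Icc 0 (dist a b), dist (h s) (h t) = |s - t|) ∧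
    h 0 = a ∧ h (dist a b) = b ∧
    ∀ q : unitInterval → T, Continuous q → Function.Injective q → q 0 = a → q 1 = b →
      range q = h '' Icc 0 (dist a b)

/-- `S` is the segment from `a` to `b`, and the only range of an injective path from `a` to `b`. -/
def IsSeg {T : Type*} [MetricSpace T] (a b : T) (S : Set T) : Prop :=
  (∃ h : ℝ → T, (∀ s ∈ Icc 0 (dist a b), ∀ t ∈ Icc 0 (dist a b), dist (h s) (h t) = |s - t|) ∧
    h 0 = a ∧ h (dist a b) = b ∧ h '' Icc 0 (dist a b) = S) ∧
  ∀ q : unitInterval → T, Continuous q → Function.Injective q → q 0 = a → q 1 = b → range q = S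

theorem isRTree_iff {T : Type*} [MetricSpace T] :
    IsRTree T ↔ ∀ a b : T, ∃ S, IsSeg a b S := by
  constructor
  · intro H a b
    obtain ⟨h, h1, h2, h3, h4⟩ := H a b
    exact ⟨_, ⟨h, h1, h2, h3, rfl⟩, h4⟩
  · intro H a b
    obtain ⟨S, ⟨h, h1, h2, h3, rfl⟩, h4⟩ := H a b
    exact ⟨h, h1, h2, h3, h4⟩

theorem IsSeg.refl {T : Type*} [MetricSpace T] (a : T) : IsSeg a a {a} := by
  refine ⟨⟨fun _ => a, ?_, rfl, rfl, ?_⟩, ?_⟩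
  · intro s hs t ht
    simp only [dist_self, Icc_self, mem_singleton_iff] at hs ht
    simp [hs, ht]
  · simp
  · intro q _ hi h0 h1
    exact absurd (hi (h0.trans h1.symm)) zero_ne_one

theorem IsSeg.symm {T : Type*} [MetricSpace T] {a b : T} {S : Set T} (H : IsSeg a b S) :
    IsSeg b a S := by
  obtain ⟨⟨h, h1, h2, h3, h4⟩, h5⟩ := H
  refine ⟨⟨fun t => h (dist a b - t), ?_, ?_, ?_, ?_⟩, ?_⟩
  · intro s hs t ht
    rw [dist_comm b a] at hs ht
    rw [h1 _ ⟨by linarith [hs.2], by linarith [hs.1]⟩ _ ⟨by linarith [ht.2], by linarith [ht.1]⟩,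
      abs_sub_comm]
    congr 1; ring
  · simpa using h3
  · simpa [dist_comm b a] using h2
  · rw [← h4, dist_comm b a]
    ext z
    constructor
    · rintro ⟨t, ht, rfl⟩
      exact ⟨_, ⟨by linarith [ht.2], by linarith [ht.1]⟩, rfl⟩
    · rintro ⟨t, ht, rfl⟩
      exact ⟨dist a b - t, ⟨by linarith [ht.2], by linarith [ht.1]⟩, by simp⟩
  · intro q hc hi h0 h1
    have := h5 (q ∘ unitInterval.symm) (hc.comp unitInterval.continuous_symm)
      (hi.comp unitInterval.symm_bijective.injective) (by simpa using h1) (by simpa using h0)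
    rw [← this, unitInterval.symm_bijective.surjective.range_comp]

theorem IsSeg.concat {T : Type*} [MetricSpace T] {a b c : T} {S S' : Set T} (H : IsSeg a c S)
    (H' : IsSeg c b S') (hd : dist a b = dist a c + dist c b)
    (hsep : ∀ q : unitInterval → T, Continuous q → q 0 = a → q 1 = b → ∃ s, q s = c) :
    IsSeg a b (S ∪ S') := by
  obtain ⟨⟨h, h1, h2, h3, h4⟩, h5⟩ := H
  obtain ⟨⟨h', h1', h2', h3', h4'⟩, h5'⟩ := H'
  have ha := dist_nonneg (x := a) (y := c)
  have hb := dist_nonneg (x := c) (y := b)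
  have key1 : ∀ t ∈ Icc 0 (dist a c), dist a (h t) = t ∧ dist (h t) c = dist a c - t := by
    intro t ht
    have e1 := h1 0 ⟨le_rfl, ha⟩ t ht
    have e2 := h1 t ht _ ⟨ha, le_rfl⟩
    rw [h2, zero_sub, abs_neg, abs_of_nonneg ht.1] at e1
    rw [h3, abs_sub_comm, abs_of_nonneg (by linarith [ht.2])] at e2
    exact ⟨e1, e2⟩
  have key2 : ∀ t ∈ Icc 0 (dist c b), dist c (h' t) = t ∧ dist (h' t) b = dist c b - t := by
    intro t ht
    have e1 := h1' 0 ⟨le_rfl, hb⟩ t ht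
    have e2 := h1' t ht _ ⟨hb, le_rfl⟩
    rw [h2', zero_sub, abs_neg, abs_of_nonneg ht.1] at e1
    rw [h3', abs_sub_comm, abs_of_nonneg (by linarith [ht.2])] at e2
    exact ⟨e1, e2⟩
  have cross : ∀ s ∈ Icc 0 (dist a c), ∀ t ∈ Icc 0 (dist c b),
      dist (h s) (h' t) = dist a c - s + t := by
    intro s hs t ht
    have := dist_triangle (h s) c (h' t)
    have := dist_triangle a (h s) b
    have := dist_triangle (h s) (h' t) b
    linarith [key1 s hs, key2 t ht, (key1 s hs).1, (key1 s hs).2, (key2 t ht).1, (key2 t ht).2]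
  have hc : h (dist a c) = h' 0 := h3.trans h2'.symm
  refine ⟨⟨fun t => if t ≤ dist a c then h t else h' (t - dist a c), ?_, ?_, ?_, ?_⟩, ?_⟩
  · have main : ∀ s ∈ Icc 0 (dist a b), ∀ t ∈ Icc 0 (dist a b), s ≤ t →
        dist (if s ≤ dist a c then h s else h' (s - dist a c))
          (if t ≤ dist a c then h t else h' (t - dist a c)) = |s - t| := by
      intro s hs t ht hst
      by_cases ht' : t ≤ dist a c
      · rw [if_pos ht', if_pos (hst.trans ht')]
        exact h1 _ ⟨hs.1, hst.trans ht'⟩ _ ⟨ht.1, ht'⟩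
      · rw [if_neg ht']
        have i2 : t - dist a c ∈ Icc 0 (dist c b) := ⟨by linarith, by linarith [ht.2]⟩
        by_cases hs' : s ≤ dist a c
        · rw [if_pos hs', cross s ⟨hs.1, hs'⟩ _ i2, abs_sub_comm, abs_of_nonneg (by linarith)]
          ring
        · rw [if_neg hs', h1' _ ⟨by linarith, by linarith [hs.2]⟩ _ i2]
          congr 1; ring
    intro s hs t ht
    rcases le_total s t with hst | hst
    · exact main s hs t ht hst
    · rw [dist_comm, abs_sub_comm]
      exact main t ht s hs hst
  · simp [ha, h2]
  · by_cases hb0 : dist c b = 0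
    · have : dist a b = dist a c := by linarith
      simp only [this, le_refl, if_true, h3]
      exact dist_eq_zero.1 hb0
    · have : ¬ dist a b ≤ dist a c := by
        intro h; exact hb0 (by linarith)
      simp only [this, if_false]
      have he : dist a b - dist a c = dist c b := by linarith
      rw [he, h3']
  · rw [← h4, ← h4']
    ext z
    constructor
    · rintro ⟨t, ht, rfl⟩
      by_cases ht' : t ≤ dist a c
      · left; exact ⟨t, ⟨ht.1, ht'⟩, by simp [ht']⟩
      · right; exact ⟨t - dist a c, ⟨by linarith, by linarith [ht.2]⟩, by simp [ht']⟩
    · rintro (⟨t, ht, rfl⟩ | ⟨t, ht, rfl⟩)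
      · exact ⟨t, ⟨ht.1, by linarith [ht.2]⟩, by simp [ht.2]⟩
      · refine ⟨t + dist a c, ⟨by linarith [ht.1], by linarith [ht.2]⟩, ?_⟩
        by_cases h0 : t = 0
        · subst h0; simpa using hc
        · have : ¬ t + dist a c ≤ dist a c := by
            have := lt_of_le_of_ne ht.1 (Ne.symm h0); linarith
          simp only [this, if_false, add_sub_cancel_right]
  · intro q hq hi h0 h1q
    obtain ⟨s, hs⟩ := hsep q hq h0 h1q
    have e1 : q '' {t | t ≤ s} = S := by
      by_cases hs0 : s = 0
      · subst hs0
        have hac : a = c := h0.symm.trans hs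
        subst hac
        have : {t : unitInterval | t ≤ 0} = {0} := by
          ext t; simp
        rw [this, image_singleton, h0, ← h4]
        simp [h2]
      · have hs0' : (0 : ℝ) < s := lt_of_le_of_ne s.2.1 (fun h => hs0 (Subtype.ext h.symm))
        rw [← h5 (fun t => q (s * t)) (by fun_prop) ?_ (by simpa using h0) (by simpa using hs)]
        · ext z
          constructor
          · rintro ⟨t, ht, rfl⟩
            refine ⟨⟨t / s, div_nonneg t.2.1 hs0'.le, (div_le_one hs0').2 ht⟩, ?_⟩
            show q _ = q t
            congr 1
            apply Subtype.ext
            show (s : ℝ) * (t / s) = t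
            field_simp
          · rintro ⟨t, rfl⟩
            exact ⟨s * t, unitInterval.mul_le_left, rfl⟩
        · intro t t' htt
          have := congrArg Subtype.val (hi htt)
          exact Subtype.ext (mul_left_cancel₀ hs0'.ne' this)
    have e2 : q '' {t | s ≤ t} = S' := by
      by_cases hs0 : s = 1
      · subst hs0
        have hac : c = b := hs.symm.trans h1q
        subst hac
        have : {t : unitInterval | 1 ≤ t} = {1} := by
          ext t
          exact ⟨fun h => le_antisymm unitInterval.le_one' h, fun h => le_of_eq h.symm⟩
        rw [this, image_singleton, h1q, ← h4']
        simp [h2']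
      · have hs0' : (0 : ℝ) < 1 - s :=
          sub_pos.2 (lt_of_le_of_ne s.2.2 (fun h => hs0 (Subtype.ext h)))
        have hmem : ∀ t : unitInterval, (s : ℝ) + (1 - s) * t ∈ Icc (0 : ℝ) 1 := fun t =>
          ⟨by nlinarith [s.2.1, t.2.1], by nlinarith [t.2.2]⟩
        rw [← h5' (fun t => q ⟨s + (1 - s) * t, hmem t⟩) (by fun_prop) ?_ ?_ ?_]
        · ext z
          constructor
          · rintro ⟨t, ht, rfl⟩
            refine ⟨⟨(t - s) / (1 - s), div_nonneg (sub_nonneg.2 ht) hs0'.le,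
              (div_le_one hs0').2 (by linarith [t.2.2])⟩, ?_⟩
            show q _ = q t
            congr 1
            apply Subtype.ext
            show (s : ℝ) + (1 - s) * ((t - s) / (1 - s)) = t
            field_simp; ring
          · rintro ⟨t, rfl⟩
            refine ⟨⟨s + (1 - s) * t, hmem t⟩, ?_, rfl⟩
            show (s : ℝ) ≤ s + (1 - s) * t
            nlinarith [t.2.1]
        · intro t t' htt
          have := congrArg Subtype.val (hi htt)
          simp only [add_right_inj] at this
          exact Subtype.ext (mul_left_cancel₀ hs0'.ne' this)
        · rw [← hs]; congr 1; apply Subtype.ext; simp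
        · rw [← h1q]; congr 1; apply Subtype.ext; simp
    rw [← e1, ← e2, ← image_union, ← image_univ]
    congr 1
    ext t
    simpa using le_total t s

/-- `c` cuts `U` off from its complement. -/
def IsCut {T : Type*} [MetricSpace T] (U : Set T) (c : T) : Prop :=
  c ∈ U ∧ ∀ z ∈ U, ∀ w ∉ U, dist z w = dist z c + dist c w

theorem IsCut.exists_eq {T : Type*} [MetricSpace T] {U : Set T} {c : T} (hU : IsCut U c)
    {q : unitInterval → T} (hq : Continuous q) {s t : unitInterval} (hst : s ≤ t)
    (h : q s ∈ U ∧ q t ∉ U ∨ q s ∉ U ∧ q t ∈ U) : ∃ r, s ≤ r ∧ r ≤ t ∧ q r = c := by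
  by_contra! hne
  have hcl : IsPreconnected (q '' Icc s t) := isPreconnected_Icc.image q hq.continuousOn
  have o1 : IsOpen (U \ {c}) := by
    rw [Metric.isOpen_iff]
    rintro z ⟨hz, hzc⟩
    refine ⟨dist z c, dist_pos.2 hzc, fun w hw => ?_⟩
    rw [Metric.mem_ball, dist_comm] at hw
    refine ⟨?_, ?_⟩
    · by_contra hwU
      have := hU.2 z hz w hwU
      linarith [dist_nonneg (x := c) (y := w)]
    · rintro rfl
      exact lt_irrefl _ hw
  have o2 : IsOpen Uᶜ := by
    rw [Metric.isOpen_iff]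
    intro z hz
    refine ⟨dist c z, dist_pos.2 (fun h => hz (h ▸ hU.1)), fun w hw => ?_⟩
    rw [Metric.mem_ball] at hw
    intro hwU
    have := hU.2 w hwU z hz
    linarith [dist_nonneg (x := w) (y := c)]
  have hs : q s ∈ q '' Icc s t := mem_image_of_mem _ ⟨le_rfl, hst⟩
  have ht : q t ∈ q '' Icc s t := mem_image_of_mem _ ⟨hst, le_rfl⟩
  have ns : q s ≠ c := hne s le_rfl hst
  have nt : q t ≠ c := hne t hst le_rfl
  obtain ⟨z, -, hz1, hz2⟩ := hcl _ _ o1 o2 (by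
    rintro _ ⟨r, hr, rfl⟩
    by_cases hrU : q r ∈ U
    · exact Or.inl ⟨hrU, hne r hr.1 hr.2⟩
    · exact Or.inr hrU)
    (by rcases h with h | h
        · exact ⟨_, hs, h.1, ns⟩
        · exact ⟨_, ht, h.2, nt⟩)
    (by rcases h with h | h
        · exact ⟨_, ht, h.2⟩
        · exact ⟨_, hs, h.1⟩)
  exact hz2 hz1.1

/-- A dilated copy of an `ℝ`-tree has the segments of an `ℝ`-tree, if no injective path leaves it. -/
theorem exists_isSeg_of_dilation {Z T : Type*} [MetricSpace Z] [MetricSpace T] (hZ : IsRTree Z)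
    (f : Z → T) {m : ℝ} (hm : 0 < m) (hf : ∀ x y, dist (f x) (f y) = m * dist x y) (x y : Z)
    (hstay : ∀ q : unitInterval → T, Continuous q → Function.Injective q → q 0 = f x →
      q 1 = f y → ∀ s, q s ∈ range f) : ∃ S, IsSeg (f x) (f y) S := by
  obtain ⟨S, ⟨h, h1, h2, h3, h4⟩, h5⟩ := isRTree_iff.1 hZ x y
  have finj : Function.Injective f := fun u v huv => by
    have := hf u v
    rw [huv, dist_self, eq_comm, mul_eq_zero] at this
    exact dist_eq_zero.1 (this.resolve_left hm.ne')
  refine ⟨f '' S, ⟨fun t => f (h (t / m)), ?_, ?_, ?_, ?_⟩, ?_⟩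
  · intro s hs t ht
    rw [hf x y] at hs ht
    rw [hf, h1 _ ⟨div_nonneg hs.1 hm.le, by rw [div_le_iff₀ hm]; linarith [hs.2]⟩
      _ ⟨div_nonneg ht.1 hm.le, by rw [div_le_iff₀ hm]; linarith [ht.2]⟩, ← sub_div, abs_div,
      abs_of_pos hm]
    field_simp
  · simp [h2]
  · simp only [hf x y]
    rw [mul_div_cancel_left₀ _ hm.ne', h3]
  · rw [← h4, hf x y]
    ext z
    constructor
    · rintro ⟨t, ht, rfl⟩
      exact ⟨_, ⟨t / m, ⟨div_nonneg ht.1 hm.le, by rw [div_le_iff₀ hm]; linarith [ht.2]⟩, rfl⟩, rfl⟩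
    · rintro ⟨_, ⟨t, ht, rfl⟩, rfl⟩
      refine ⟨m * t, ⟨mul_nonneg hm.le ht.1, mul_le_mul_of_nonneg_left ht.2 hm.le⟩, ?_⟩
      simp only
      rw [mul_div_cancel_left₀ _ hm.ne']
  · intro q hq hi h0 h1q
    choose g hg using hstay q hq hi h0 h1q
    have hgc : Continuous g := by
      rw [Metric.continuous_iff]
      intro b ε hε
      obtain ⟨δ, hδ, H⟩ := Metric.continuous_iff.1 hq b (m * ε) (by positivity)
      refine ⟨δ, hδ, fun a ha => ?_⟩
      have := H a ha
      rw [← hg a, ← hg b, hf] at this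
      exact lt_of_mul_lt_mul_left this hm.le
    have := h5 g hgc (fun s t hst => hi (by rw [← hg s, ← hg t, hst]))
      (finj ((hg 0).trans h0)) (finj ((hg 1).trans h1q))
    rw [← this, ← range_comp]
    congr 1
    exact (funext hg).symm

theorem isRTree_Icc (ℓ : ℝ) : IsRTree (Icc (0 : ℝ) ℓ) := by
  have main : ∀ a b : Icc (0 : ℝ) ℓ, a ≤ b → ∃ S, IsSeg a b S := by
    intro a b hab
    have hab' : (a : ℝ) ≤ b := hab
    have hd : dist a b = b - a := by
      rw [Subtype.dist_eq, dist_comm, Real.dist_eq, abs_of_nonneg (by linarith)]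
    have hp : ∀ t : ℝ, t ∈ Icc 0 (dist a b) → (a : ℝ) + t ∈ Icc (0 : ℝ) ℓ := fun t ht =>
      ⟨add_nonneg a.2.1 ht.1, by rw [hd] at ht; linarith [ht.2, b.2.2]⟩
    have h0l : (0 : ℝ) ≤ ℓ := a.2.1.trans a.2.2
    have hv : ∀ t : ℝ, t ∈ Icc 0 (dist a b) → (projIcc 0 ℓ h0l (a + t) : ℝ) = a + t := fun t ht =>
      by rw [projIcc_of_mem h0l (hp t ht)]
    have m0 : (0 : ℝ) ∈ Icc 0 (dist a b) := ⟨le_rfl, dist_nonneg⟩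
    have m1 : dist a b ∈ Icc 0 (dist a b) := ⟨dist_nonneg, le_rfl⟩
    have hr : (fun t : ℝ => projIcc 0 ℓ h0l (a + t)) '' Icc 0 (dist a b) = Icc a b := by
      ext z
      constructor
      · rintro ⟨t, ht, rfl⟩
        have := hv t ht
        rw [hd] at ht
        refine ⟨Subtype.coe_le_coe.1 ?_, Subtype.coe_le_coe.1 ?_⟩ <;> rw [this] <;>
          linarith [ht.1, ht.2]
      · rintro ⟨hz1, hz2⟩
        have hz1' : (a : ℝ) ≤ z := hz1
        have hz2' : (z : ℝ) ≤ b := hz2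
        have hm : (z : ℝ) - a ∈ Icc 0 (dist a b) := ⟨by linarith, by rw [hd]; linarith⟩
        exact ⟨z - a, hm, Subtype.ext (by simp only; rw [hv _ hm]; ring)⟩
    refine ⟨Icc a b, ⟨fun t => projIcc 0 ℓ h0l (a + t), ?_, ?_, ?_, hr⟩, ?_⟩
    · intro s hs t ht
      rw [Subtype.dist_eq, hv s hs, hv t ht, Real.dist_eq]
      congr 1; ring
    · exact Subtype.ext (by rw [hv 0 m0]; ring)
    · exact Subtype.ext (by rw [hv _ m1, hd]; ring)
    · intro q hq hi h0 h1
      have hmono : StrictMono q := hq.strictMono_of_inj_boundedOrder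
        (by show q 0 ≤ q 1; rw [h0, h1]; exact hab) hi
      apply Subset.antisymm
      · rintro _ ⟨s, rfl⟩
        rw [← h0, ← h1]
        exact ⟨hmono.monotone unitInterval.nonneg', hmono.monotone unitInterval.le_one'⟩
      · rw [← h0, ← h1, ← image_univ]
        have := intermediate_value_Icc (zero_le_one (α := unitInterval)) hq.continuousOn
        exact this.trans (image_mono (subset_univ _))
  rw [isRTree_iff]
  intro a b
  rcases le_total a b with h | h
  · exact main a b h
  · obtain ⟨S, hS⟩ := main b a h
    exact ⟨S, hS.symm⟩

/-- A compact rooted `ℝ`-tree. -/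
structure RootedTree : Type 1 where
  carrier : Type
  [metric : MetricSpace carrier]
  [compact : CompactSpace carrier]
  root : carrier
  isRTree : IsRTree carrier

attribute [instance] RootedTree.metric RootedTree.compact

/-- Root-preserving isometry of `T` onto `T'`. -/
def RootedTree.Equivalent (T T' : RootedTree) : Prop :=
  ∃ e : T.carrier ≃ᵢ T'.carrier, e T.root = T'.root

instance RootedTree.setoid : Setoid RootedTree where
  r := RootedTree.Equivalent
  iseqv :=
    { refl := fun _ => ⟨IsometryEquiv.refl _, rfl⟩
      symm := fun ⟨e, he⟩ => ⟨e.symm, by rw [← he, e.symm_apply_apply]⟩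
      trans := fun ⟨e, he⟩ ⟨f, hf⟩ => ⟨e.trans f, by rw [IsometryEquiv.trans_apply, he, hf]⟩ }

/-- The space of equivalence classes of compact rooted `ℝ`-trees. -/
def TreeSpace : Type 1 := Quotient RootedTree.setoid

namespace TreeSpace

/-- The values `max (δ(φ(ρ), φ'(ρ'))) (δ_H(φ(T), φ'(T')))`, over all metric spaces `(M, δ)` and all
isometric embeddings `φ : T → M` and `φ' : T' → M`. -/
def ghValues (T T' : RootedTree) : Set ℝ :=
  {r | ∃ (M : Type) (_ : MetricSpace M) (φ : T.carrier → M) (φ' : T'.carrier → M),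
    Isometry φ ∧ Isometry φ' ∧
    r = max (dist (φ T.root) (φ' T'.root)) (Metric.hausdorffDist (range φ) (range φ'))}

theorem ghValues_subset {T₁ T₁' T₂ T₂' : RootedTree} (h : T₁ ≈ T₂) (h' : T₁' ≈ T₂') :
    ghValues T₁ T₁' ⊆ ghValues T₂ T₂' := by
  obtain ⟨e, he⟩ := h
  obtain ⟨e', he'⟩ := h'
  rintro r ⟨M, hM, φ, φ', hφ, hφ', rfl⟩
  refine ⟨M, hM, φ ∘ e.symm, φ' ∘ e'.symm, hφ.comp e.symm.isometry, hφ'.comp e'.symm.isometry, ?_⟩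
  rw [e.symm.surjective.range_comp, e'.symm.surjective.range_comp, ← he, ← he']
  simp

/-- The pointed Gromov-Hausdorff distance. -/
noncomputable def ghDist : TreeSpace → TreeSpace → ℝ :=
  Quotient.lift₂ (fun T T' => sInf (ghValues T T')) fun _ _ _ _ h h' =>
    congrArg sInf ((ghValues_subset h h').antisymm
      (ghValues_subset (Setoid.symm h) (Setoid.symm h')))

/-- The height of a tree. -/
noncomputable def height : TreeSpace → ℝ :=
  Quotient.lift (fun T => ⨆ x : T.carrier, dist T.root x) fun T T' h => by
    obtain ⟨e, he⟩ := h
    show (⨆ x : T.carrier, dist T.root x) = ⨆ x : T'.carrier, dist T'.root x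
    rw [← e.toEquiv.iSup_comp, ← he]
    exact iSup_congr fun x => (e.isometry.dist_eq _ _).symm

/-- The topology of the Gromov-Hausdorff distance, generated by its open balls. -/
instance : TopologicalSpace TreeSpace :=
  TopologicalSpace.generateFrom {B | ∃ (t : TreeSpace) (r : ℝ), B = {t' | ghDist t' t < r}}

instance : MeasurableSpace TreeSpace := borel TreeSpace

instance : BorelSpace TreeSpace := ⟨rfl⟩

end TreeSpace

theorem isRTree_unit : IsRTree PUnit.{1} :=
  isRTree_iff.2 fun a _ => ⟨{a}, IsSeg.refl a⟩

/-- The one-point tree. -/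
def pointTree : RootedTree where
  carrier := PUnit
  root := PUnit.unit
  isRTree := isRTree_unit

/-- A string `([0, len], (loc i), (mass i))`: an interval with countably many atoms of masses `mass i`
at locations `loc i`, which need not be distinct, with no condition on the sum of the masses. -/
@[ext]
structure GenString where
  len : ℝ
  loc : ℕ → ℝ
  mass : ℕ → ℝ
  loc_mem : ∀ i, loc i ∈ Icc 0 len
  mass_nonneg : ∀ i, 0 ≤ mass i

/-- The product `σ`-algebra, making `len` and all `loc i`, `mass i` measurable. -/
instance : MeasurableSpace GenString :=
  MeasurableSpace.comap (fun s => (s.len, s.loc, s.mass))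
    (inferInstance : MeasurableSpace (ℝ × (ℕ → ℝ) × (ℕ → ℝ)))

/-- The points of the branch `[0, len]` and of the trees `T i`, before the root of `T i` is identified
with the point `loc i` of the branch. -/
inductive Graft (β : ℝ) (s : GenString) (T : ℕ → RootedTree) : Type
  | base (x : Icc (0 : ℝ) s.len) : Graft β s T
  | tree (i : ℕ) (y : (T i).carrier) : Graft β s T

namespace Graft

variable {β : ℝ} {s : GenString} {T : ℕ → RootedTree}

open Classical in
/-- Distances in the branch with the trees `(mass i) ^ β • T i` attached at the points `loc i`. -/
noncomputable def graftDist : Graft β s T → Graft β s T → ℝ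
  | base x, base y => |(x : ℝ) - y|
  | base x, tree j y => |(x : ℝ) - s.loc j| + s.mass j ^ β * dist (T j).root y
  | tree i x, base y => s.mass i ^ β * dist x (T i).root + |s.loc i - y|
  | tree i x, tree j y =>
    if h : i = j then s.mass j ^ β * dist (cast (congrArg (fun k => (T k).carrier) h) x) y
    else s.mass i ^ β * dist x (T i).root + |s.loc i - s.loc j| + s.mass j ^ β * dist (T j).root y

theorem graftDist_same (i : ℕ) (x y : (T i).carrier) :
    graftDist (tree i x : Graft β s T) (tree i y) = s.mass i ^ β * dist x y := by
  simp [graftDist]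

theorem graftDist_ne {i j : ℕ} (h : i ≠ j) (x : (T i).carrier) (y : (T j).carrier) :
    graftDist (tree i x : Graft β s T) (tree j y) = s.mass i ^ β * dist x (T i).root
      + |s.loc i - s.loc j| + s.mass j ^ β * dist (T j).root y := by
  simp [graftDist, h]

theorem factor_nonneg (β : ℝ) (s : GenString) (i : ℕ) : 0 ≤ s.mass i ^ β :=
  Real.rpow_nonneg (s.mass_nonneg i) β

theorem graftDist_comm (a b : Graft β s T) : graftDist a b = graftDist b a := by
  rcases a with x | ⟨i, x⟩ <;> rcases b with y | ⟨j, y⟩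
  · exact abs_sub_comm _ _
  · simp only [graftDist]; rw [abs_sub_comm, dist_comm]; ring
  · simp only [graftDist]; rw [abs_sub_comm, dist_comm]; ring
  · by_cases h : i = j
    · subst h; rw [graftDist_same, graftDist_same, dist_comm]
    · rw [graftDist_ne h, graftDist_ne (Ne.symm h), abs_sub_comm, dist_comm, dist_comm y]; ring

theorem graftDist_triangle (a b c : Graft β s T) :
    graftDist a c ≤ graftDist a b + graftDist b c := by
  have tri : ∀ (i : ℕ) (x y z : (T i).carrier),
      s.mass i ^ β * dist x z ≤ s.mass i ^ β * dist x y + s.mass i ^ β * dist y z := by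
    intro i x y z
    rw [← mul_add]
    exact mul_le_mul_of_nonneg_left (dist_triangle _ _ _) (factor_nonneg β s i)
  have pos : ∀ (i : ℕ) (x y : (T i).carrier), 0 ≤ s.mass i ^ β * dist x y := fun i x y =>
    mul_nonneg (factor_nonneg β s i) dist_nonneg
  rcases a with x | ⟨i, x⟩ <;> rcases b with y | ⟨j, y⟩ <;> rcases c with z | ⟨k, z⟩
  · exact abs_sub_le _ _ _
  · simp only [graftDist]
    linarith [abs_sub_le (x : ℝ) y (s.loc k)]
  · simp only [graftDist]
    linarith [abs_sub_le (x : ℝ) (s.loc j) z, pos j (T j).root y, pos j y (T j).root]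
  · by_cases h : j = k
    · subst h
      rw [graftDist_same]
      simp only [graftDist]
      linarith [tri j (T j).root y z]
    · rw [graftDist_ne h]
      simp only [graftDist]
      linarith [abs_sub_le (x : ℝ) (s.loc j) (s.loc k), pos j (T j).root y, pos j y (T j).root]
  · simp only [graftDist]
    linarith [abs_sub_le (s.loc i) y z]
  · by_cases h : i = k
    · subst h
      rw [graftDist_same]
      simp only [graftDist]
      linarith [tri i x (T i).root z, abs_nonneg (s.loc i - y), abs_nonneg (y - s.loc i)]
    · rw [graftDist_ne h]
      simp only [graftDist]
      linarith [abs_sub_le (s.loc i) y (s.loc k)]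
  · by_cases h : i = j
    · subst h
      rw [graftDist_same]
      simp only [graftDist]
      linarith [tri i x y (T i).root]
    · rw [graftDist_ne h]
      simp only [graftDist]
      linarith [abs_sub_le (s.loc i) (s.loc j) z, pos j (T j).root y, pos j y (T j).root]
  · by_cases h : i = j
    · subst h
      by_cases h' : i = k
      · subst h'
        simp only [graftDist_same]
        exact tri i x y z
      · rw [graftDist_same, graftDist_ne h', graftDist_ne h']
        linarith [tri i x y (T i).root]
    · by_cases h' : j = k
      · subst h'
        rw [graftDist_same, graftDist_ne h, graftDist_ne h]
        linarith [tri j (T j).root y z]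
      · rw [graftDist_ne h, graftDist_ne h']
        by_cases h'' : i = k
        · subst h''
          rw [graftDist_same]
          linarith [tri i x (T i).root z, abs_nonneg (s.loc i - s.loc j),
            abs_nonneg (s.loc j - s.loc i), pos j (T j).root y, pos j y (T j).root]
        · rw [graftDist_ne h'']
          linarith [abs_sub_le (s.loc i) (s.loc j) (s.loc k), pos j (T j).root y,
            pos j y (T j).root]

noncomputable instance : PseudoMetricSpace (Graft β s T) where
  dist := graftDist
  dist_self a := by
    rcases a with x | ⟨i, x⟩
    · show |(x : ℝ) - x| = 0
      simp
    · show graftDist _ _ = 0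
      rw [graftDist_same, dist_self, mul_zero]
  dist_comm := graftDist_comm
  dist_triangle := graftDist_triangle

theorem dist_eq (a b : Graft β s T) : dist a b = graftDist a b := rfl

theorem dist_mk (a b : Graft β s T) :
    dist (SeparationQuotient.mk a) (SeparationQuotient.mk b) = graftDist a b :=
  SeparationQuotient.dist_mk a b

/-- The point at which `T i` is attached. -/
noncomputable def attach (β : ℝ) (s : GenString) (T : ℕ → RootedTree) (i : ℕ) :
    SeparationQuotient (Graft β s T) :=
  SeparationQuotient.mk (base ⟨s.loc i, s.loc_mem i⟩)

/-- The copy of `T i` in the tree. -/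
def branch (β : ℝ) (s : GenString) (T : ℕ → RootedTree) (i : ℕ) :
    Set (SeparationQuotient (Graft β s T)) :=
  range fun y : (T i).carrier => SeparationQuotient.mk (tree i y)

theorem mk_root (i : ℕ) :
    SeparationQuotient.mk (tree i (T i).root : Graft β s T) = attach β s T i := by
  rw [← dist_eq_zero, attach, dist_mk]
  simp [graftDist]

theorem isCut (i : ℕ) : IsCut (branch β s T i) (attach β s T i) := by
  refine ⟨⟨_, mk_root i⟩, ?_⟩
  rintro _ ⟨x, rfl⟩ w hw
  obtain ⟨b, rfl⟩ := SeparationQuotient.surjective_mk w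
  simp only [attach, dist_mk]
  rcases b with y | ⟨j, y⟩
  · simp [graftDist]
  · by_cases h : i = j
    · subst h
      exact absurd ⟨y, rfl⟩ hw
    · rw [graftDist_ne h]
      simp [graftDist]
      ring

/-- The branch with the rescaled trees attached is an `ℝ`-tree. -/
theorem isRTree (β : ℝ) (s : GenString) (T : ℕ → RootedTree) :
    IsRTree (SeparationQuotient (Graft β s T)) := by
  -- an injective path that starts and ends outside a branch, or at its root, does not enter it
  have hout : ∀ (i : ℕ) (q : unitInterval → SeparationQuotient (Graft β s T)), Continuous q →
      Function.Injective q → (q 0 = attach β s T i ∨ q 0 ∉ branch β s T i) →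
      (q 1 = attach β s T i ∨ q 1 ∉ branch β s T i) → ∀ t, q t ∈ branch β s T i →
      q t = attach β s T i := by
    intro i q hq hi h0 h1 t ht
    have e0 : ∃ r, r ≤ t ∧ q r = attach β s T i := by
      rcases h0 with h0 | h0
      · exact ⟨0, unitInterval.nonneg', h0⟩
      · obtain ⟨r, -, hr, hr'⟩ := (isCut i).exists_eq hq (s := 0) (t := t) unitInterval.nonneg'
          (Or.inr ⟨h0, ht⟩)
        exact ⟨r, hr, hr'⟩
    have e1 : ∃ r, t ≤ r ∧ q r = attach β s T i := by
      rcases h1 with h1 | h1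
      · exact ⟨1, unitInterval.le_one', h1⟩
      · obtain ⟨r, hr, -, hr'⟩ := (isCut i).exists_eq hq (s := t) (t := 1) unitInterval.le_one'
          (Or.inl ⟨ht, h1⟩)
        exact ⟨r, hr, hr'⟩
    obtain ⟨r, hr, hrq⟩ := e0
    obtain ⟨r', hr', hrq'⟩ := e1
    have : r = r' := hi (hrq.trans hrq'.symm)
    subst this
    rw [← hrq, le_antisymm hr hr']
  have hbb : ∀ x y : Icc (0 : ℝ) s.len, ∃ S, IsSeg
      (SeparationQuotient.mk (base x : Graft β s T)) (SeparationQuotient.mk (base y)) S := by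
    intro x y
    refine exists_isSeg_of_dilation (isRTree_Icc s.len)
      (fun x => SeparationQuotient.mk (base x : Graft β s T)) one_pos
      (fun u v => by rw [dist_mk, one_mul]; rfl) x y ?_
    intro q hq hi h0 h1 t
    have hb : ∀ (i : ℕ) (z : Icc (0 : ℝ) s.len),
        SeparationQuotient.mk (base z : Graft β s T) = attach β s T i ∨
        SeparationQuotient.mk (base z : Graft β s T) ∉ branch β s T i := by
      intro i z
      by_contra! hz
      obtain ⟨y, hy⟩ := hz.2
      refine hz.1 (dist_eq_zero.1 ?_)
      have hd := dist_eq_zero.2 hy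
      rw [dist_mk] at hd
      rw [attach, dist_mk]
      simp only [graftDist] at hd ⊢
      rw [abs_sub_comm]
      linarith [abs_nonneg (s.loc i - z), mul_nonneg (factor_nonneg β s i)
        (dist_nonneg (x := y) (y := (T i).root))]
    obtain ⟨g, hg⟩ := SeparationQuotient.surjective_mk (q t)
    rcases g with z | ⟨i, z⟩
    · exact ⟨z, hg⟩
    · rw [hout i q hq hi (h0 ▸ hb i x) (h1 ▸ hb i y) t ⟨z, hg⟩]
      exact ⟨_, rfl⟩
  have htt : ∀ (i : ℕ) (x y : (T i).carrier), ∃ S, IsSeg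
      (SeparationQuotient.mk (tree i x : Graft β s T)) (SeparationQuotient.mk (tree i y)) S := by
    intro i x y
    rcases (factor_nonneg β s i).eq_or_lt with hm | hm
    · have : SeparationQuotient.mk (tree i x : Graft β s T) = SeparationQuotient.mk (tree i y) := by
        rw [← dist_eq_zero, dist_mk, graftDist_same, ← hm, zero_mul]
      rw [this]
      exact ⟨_, IsSeg.refl _⟩
    · refine exists_isSeg_of_dilation (T i).isRTree
        (fun x => SeparationQuotient.mk (tree i x : Graft β s T)) hm
        (fun u v => by rw [dist_mk, graftDist_same]) x y ?_
      intro q hq hi h0 h1 t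
      by_contra ht
      have m0 : q 0 ∈ branch β s T i := ⟨x, h0.symm⟩
      have m1 : q 1 ∈ branch β s T i := ⟨y, h1.symm⟩
      obtain ⟨r, -, hr, hrq⟩ := (isCut i).exists_eq hq (s := 0) (t := t) unitInterval.nonneg'
        (Or.inl ⟨m0, ht⟩)
      obtain ⟨r', hr', -, hrq'⟩ := (isCut i).exists_eq hq (s := t) (t := 1) unitInterval.le_one'
        (Or.inr ⟨ht, m1⟩)
      have : r = r' := hi (hrq.trans hrq'.symm)
      subst this
      rw [le_antisymm hr' hr, hrq] at ht
      exact ht (isCut i).1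
  -- from a point of a branch to a point outside, through the root of the branch
  have hcat : ∀ (i : ℕ) (x : (T i).carrier) (w : SeparationQuotient (Graft β s T)),
      w ∉ branch β s T i → (∃ S, IsSeg (attach β s T i) w S) →
      ∃ S, IsSeg (SeparationQuotient.mk (tree i x : Graft β s T)) w S := by
    rintro i x w hw ⟨S, hS⟩
    obtain ⟨S', hS'⟩ := htt i x (T i).root
    rw [mk_root] at hS'
    refine ⟨_, hS'.concat hS ((isCut i).2 _ ⟨x, rfl⟩ w hw) ?_⟩
    intro q hq h0 h1
    obtain ⟨r, -, -, hr⟩ := (isCut i).exists_eq hq (s := 0) (t := 1) unitInterval.nonneg'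
      (Or.inl ⟨⟨x, h0.symm⟩, h1 ▸ hw⟩)
    exact ⟨r, hr⟩
  have htb : ∀ (i : ℕ) (x : (T i).carrier) (y : Icc (0 : ℝ) s.len), ∃ S, IsSeg
      (SeparationQuotient.mk (tree i x : Graft β s T)) (SeparationQuotient.mk (base y)) S := by
    intro i x y
    by_cases hy : SeparationQuotient.mk (base y : Graft β s T) ∈ branch β s T i
    · obtain ⟨z, hz⟩ := hy
      rw [← hz]
      exact htt i x z
    · exact hcat i x _ hy (hbb _ _)
  rw [isRTree_iff]
  intro a b
  obtain ⟨a, rfl⟩ := SeparationQuotient.surjective_mk a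
  obtain ⟨b, rfl⟩ := SeparationQuotient.surjective_mk b
  rcases a with x | ⟨i, x⟩ <;> rcases b with y | ⟨j, y⟩
  · exact hbb x y
  · obtain ⟨S, hS⟩ := htb j y x
    exact ⟨S, hS.symm⟩
  · exact htb i x y
  · by_cases hy : SeparationQuotient.mk (tree j y : Graft β s T) ∈ branch β s T i
    · obtain ⟨z, hz⟩ := hy
      rw [← hz]
      exact htt i x z
    · obtain ⟨S, hS⟩ := htb j y ⟨s.loc i, s.loc_mem i⟩
      exact hcat i x _ hy ⟨S, hS.symm⟩

end Graft

/-- The metric space obtained by attaching the trees `(mass i) ^ β • T i` to `[0, len]`, each by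
identification of its root with the point `loc i`. -/
abbrev Grafted (β : ℝ) (s : GenString) (T : ℕ → RootedTree) : Type :=
  SeparationQuotient (Graft β s T)

/-- The rooted tree `Grafted β s T`, with root `0 ∈ [0, len]`, when it is compact. -/
noncomputable def graftedTree (β : ℝ) (s : GenString) (T : ℕ → RootedTree)
    (h : CompactSpace (Grafted β s T)) : RootedTree where
  carrier := Grafted β s T
  compact := h
  root := SeparationQuotient.mk (Graft.base ⟨0, le_rfl, (s.loc_mem 0).1.trans (s.loc_mem 0).2⟩)
  isRTree := Graft.isRTree β s T

open Classical in
/-- The map `φ_β`: the class of the grafted tree if this is compact, the one-point tree otherwise. -/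
noncomputable def graftMap (β : ℝ) (s : GenString) (τ : ℕ → TreeSpace) : TreeSpace :=
  if h : CompactSpace (Grafted β s fun i => (τ i).out) then ⟦graftedTree β s _ h⟧ else ⟦pointTree⟧

/-- The law of `φ_β(ξ, τ_i, i ≥ 1)`, where `ξ` has law `ν`, the `τ_i` are i.i.d. with law `η`, and
`ξ` is independent of `(τ_i)`. -/
noncomputable def graftLaw (β : ℝ) (ν : Measure GenString) (η : Measure TreeSpace) :
    Measure TreeSpace :=
  (ν.prod (Measure.infinitePi fun _ : ℕ => η)).map fun z => graftMap β z.1 z.2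

/-- The probability measures on `TreeSpace` for which the height has a finite `p`-th moment. -/
def TreeLaw (p : ℝ) : Type 1 :=
  {η : ProbabilityMeasure TreeSpace //
    ∫⁻ t, ENNReal.ofReal (t.height ^ p) ∂(η : Measure TreeSpace) < ∞}

/-- The Wasserstein distance of order `p` with respect to the Gromov-Hausdorff distance. -/
noncomputable def wasserstein (p : ℝ) (η η' : Measure TreeSpace) : ℝ≥0∞ :=
  (⨅ π : {π : Measure (TreeSpace × TreeSpace) // π.map Prod.fst = η ∧ π.map Prod.snd = η'},
    ∫⁻ z, ENNReal.ofReal (TreeSpace.ghDist z.1 z.2 ^ p) ∂π.1) ^ (1 / p)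

end RDE

namespace RDE

/-! Grafting contracts in the mean. Two families of trees grafted on the same string give trees
whose distance is at most the supremum of the rescaled distances $P_i^\beta d(\tau_i,\tau_i')$. With
the supremum bounded by the $\ell^p$ sum and with independence, the mean of $d^p$ is multiplied by
at most $c=\mathbb E[\sum_j P_j^{p\beta}]<1$ (`edist_graftMap_rpow_le`,
`lintegral_edist_graftMap_le`).

The supremum bound needs a suitable metric. A path between two grafted trees runs through both of
their roots, where the errors add up. A Gromov–Hausdorff distance below $r$ only controls distances
to the root up to $2r$, which would give a total error $4r$. So `pinDist` is used: correspondences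
with distortion $r$ for distances to the root and $2r$ for all others. It satisfies `ghDist` ≤
`pinDist` ≤ 2 `ghDist`, so topology and convergence are the same.

The grafted tree is compact exactly when the rescaled heights tend to $0$ (`graftable_iff`). If
$\eta$ has a finite $p$-th moment, $\sum_i P_i^{p\beta}\,{\rm ht}(\tau_i)^p$ is almost surely
finite, so the grafted tree is almost surely compact, and its height is at most $L$ plus the $p$-th
root of that sum; this preserves moments.

For existence, i.i.d. strings are placed at all finite words. The $n$-generation trees `growTree`
have $L^p$ increments that decay geometrically, so they converge in the complete space `TreeSpace`.
Grafting the limits that belong to the subfamilies reproduces the limit, whose law is therefore a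
fixpoint (`exists_fixpoint`). No completeness of $W_p$ is used.

For uniqueness and convergence, a coupling of $\eta$ and $\eta^*$ of finite cost $K$ is carried to
one of $\Phi^n(\eta)$ and $\eta^*$ of cost at most $c^nK$ (`exists_coupling_graftLaw`), and
arbitrarily cheap couplings force equality (`eq_of_forall_coupling`).

Completeness and separability of `TreeSpace` come from the unrooted space `GHSpace`. A limit of
$\mathbb R$-trees is an $\mathbb R$-tree since these are the geodesic spaces with the four-point
condition, and both properties survive limits. Measurability of grafting comes from continuity for
strings with finitely many atoms. -/

instance (T : RootedTree) : Nonempty T.carrier := ⟨T.root⟩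

/-! ### Correspondences between rooted trees -/

/-- There is a correspondence between `T` and `T'` that relates the roots, with distortion at most
`b`, and with distortion at most `a` for the distances to the roots. -/
def Corr (T T' : RootedTree) (a b : ℝ) : Prop :=
  ∃ R : T.carrier → T'.carrier → Prop, (∀ x, ∃ x', R x x') ∧ (∀ x', ∃ x, R x x') ∧
    R T.root T'.root ∧ (∀ x x', R x x' → |dist T.root x - dist T'.root x'| ≤ a) ∧
    ∀ x x' y y', R x x' → R y y' → |dist x y - dist x' y'| ≤ b

namespace Corr

variable {T T' T'' : RootedTree} {a a' b b' : ℝ}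

theorem nonneg_left (h : Corr T T' a b) : 0 ≤ a := by
  obtain ⟨R, -, -, h0, h1, -⟩ := h
  exact (abs_nonneg _).trans (h1 _ _ h0)

theorem nonneg_right (h : Corr T T' a b) : 0 ≤ b := by
  obtain ⟨R, -, -, h0, -, h1⟩ := h
  exact (abs_nonneg _).trans (h1 _ _ _ _ h0 h0)

theorem mono (h : Corr T T' a b) (ha : a ≤ a') (hb : b ≤ b') : Corr T T' a' b' := by
  obtain ⟨R, h1, h2, h3, h4, h5⟩ := h
  exact ⟨R, h1, h2, h3, fun x x' h => (h4 x x' h).trans ha,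
    fun x x' y y' h h' => (h5 x x' y y' h h').trans hb⟩

theorem symm (h : Corr T T' a b) : Corr T' T a b := by
  obtain ⟨R, h1, h2, h3, h4, h5⟩ := h
  exact ⟨fun x x' => R x' x, h2, h1, h3, fun x x' h => abs_sub_comm (dist T.root x') _ ▸ h4 _ _ h,
    fun x x' y y' h h' => abs_sub_comm (dist x' y') _ ▸ h5 _ _ _ _ h h'⟩

theorem trans (h : Corr T T' a b) (h' : Corr T' T'' a' b') : Corr T T'' (a + a') (b + b') := by
  obtain ⟨R, h1, h2, h3, h4, h5⟩ := h
  obtain ⟨R', h1', h2', h3', h4', h5'⟩ := h'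
  refine ⟨fun x z => ∃ y, R x y ∧ R' y z, fun x => ?_, fun z => ?_, ⟨_, h3, h3'⟩, ?_, ?_⟩
  · obtain ⟨y, hy⟩ := h1 x
    obtain ⟨z, hz⟩ := h1' y
    exact ⟨z, y, hy, hz⟩
  · obtain ⟨y, hy⟩ := h2' z
    obtain ⟨x, hx⟩ := h2 y
    exact ⟨x, y, hx, hy⟩
  · rintro x z ⟨y, hy, hy'⟩
    exact (abs_sub_le _ (dist T'.root y) _).trans (add_le_add (h4 _ _ hy) (h4' _ _ hy'))
  · rintro x x'' y y'' ⟨x', hx, hx'⟩ ⟨y', hy, hy'⟩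
    exact (abs_sub_le _ (dist x' y') _).trans (add_le_add (h5 _ _ _ _ hx hy) (h5' _ _ _ _ hx' hy'))

theorem of_equiv (h : T ≈ T') : Corr T T' 0 0 := by
  obtain ⟨e, he⟩ := h
  refine ⟨fun x x' => e x = x', fun x => ⟨_, rfl⟩, fun x' => e.surjective x', he, ?_, ?_⟩
  · rintro x _ rfl
    rw [← he, e.isometry.dist_eq, sub_self, abs_zero]
  · rintro x _ y _ rfl rfl
    rw [e.isometry.dist_eq, sub_self, abs_zero]

theorem out (T : RootedTree) : Corr T (⟦T⟧ : TreeSpace).out 0 0 :=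
  of_equiv (Setoid.symm (Quotient.mk_out T))

theorem dist_root_le (T : RootedTree) :
    BddAbove (range fun x : T.carrier => dist T.root x) :=
  (isCompact_range (by fun_prop)).bddAbove

/-- The relation that holds between all points. -/
theorem univ (T T' : RootedTree) {h h' : ℝ} (hT : ∀ x, dist T.root x ≤ h)
    (hT' : ∀ x, dist T'.root x ≤ h') : Corr T T' (max h h') (2 * max h h') := by
  refine ⟨fun _ _ => True, fun _ => ⟨T'.root, trivial⟩, fun _ => ⟨T.root, trivial⟩, trivial,
    fun x x' _ => ?_, fun x x' y y' _ _ => ?_⟩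
  · rw [abs_le]
    have := hT x
    have := hT' x'
    constructor <;> linarith [le_max_left h h', le_max_right h h', dist_nonneg (x := T.root) (y := x),
      dist_nonneg (x := T'.root) (y := x')]
  · rw [abs_le]
    have := hT x
    have := hT' x'
    have := hT y
    have := hT' y'
    have := dist_triangle_left x y T.root
    have := dist_triangle_left x' y' T'.root
    constructor <;> linarith [le_max_left h h', le_max_right h h', dist_nonneg (x := x) (y := y),
      dist_nonneg (x := x') (y := y')]

/-- Both trees are glued into one space with related points at distance `r`. Distortion at most `2 *
r` gives the triangle inequality, and `0 < r` keeps the glued distance a metric. -/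
theorem exists_ghValues {r : ℝ} (h : Corr T T' a (2 * r)) (hr : 0 < r) :
    ∃ v ∈ TreeSpace.ghValues T T', v ≤ r := by
  obtain ⟨R, h1, h2, h3, h4, h5⟩ := h
  let Z := {z : T.carrier × T'.carrier // R z.1 z.2}
  have : Nonempty Z := ⟨⟨(_, _), h3⟩⟩
  let Φ : Z → T.carrier := fun z => z.1.1
  let Ψ : Z → T'.carrier := fun z => z.1.2
  let : MetricSpace (T.carrier ⊕ T'.carrier) := Metric.glueMetricApprox Φ Ψ r hr
    (fun p q => h5 _ _ _ _ p.2 q.2)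
  have key : ∀ x x', R x x' → dist (Sum.inl x : T.carrier ⊕ T'.carrier) (Sum.inr x') = r :=
    fun x x' h => Metric.glueDist_glued_points Φ Ψ r ⟨(x, x'), h⟩
  refine ⟨_, ⟨T.carrier ⊕ T'.carrier, inferInstance, Sum.inl, Sum.inr,
    Isometry.of_dist_eq fun _ _ => rfl, Isometry.of_dist_eq fun _ _ => rfl, rfl⟩, ?_⟩
  refine max_le (key _ _ h3).le (Metric.hausdorffDist_le_of_mem_dist hr.le ?_ ?_)
  · rintro _ ⟨x, rfl⟩
    obtain ⟨x', hx'⟩ := h1 x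
    exact ⟨_, ⟨x', rfl⟩, (key _ _ hx').le⟩
  · rintro _ ⟨x', rfl⟩
    obtain ⟨x, hx⟩ := h2 x'
    exact ⟨_, ⟨x, rfl⟩, by rw [dist_comm]; exact (key _ _ hx).le⟩

end Corr

/-! ### The Gromov–Hausdorff distance, the pinned distance and their common topology -/

namespace TreeSpace

theorem bddBelow_ghValues (T T' : RootedTree) : BddBelow (ghValues T T') := by
  refine ⟨0, ?_⟩
  rintro r ⟨M, _, φ, φ', -, -, rfl⟩
  exact dist_nonneg.trans (le_max_left _ _)

theorem nonempty_ghValues (T T' : RootedTree) : (ghValues T T').Nonempty := by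
  obtain ⟨h, hh⟩ := Corr.dist_root_le T
  obtain ⟨h', hh'⟩ := Corr.dist_root_le T'
  have := (Corr.univ T T' (fun x => hh ⟨x, rfl⟩) (fun x => hh' ⟨x, rfl⟩)).mono
    (le_max_left _ 1) (mul_le_mul_of_nonneg_left (le_max_left _ 1) zero_le_two)
  obtain ⟨v, hv, -⟩ := this.exists_ghValues (lt_max_of_lt_right one_pos)
  exact ⟨v, hv⟩

theorem ghDist_mk (T T' : RootedTree) : ghDist ⟦T⟧ ⟦T'⟧ = sInf (ghValues T T') := rfl

theorem ghDist_nonneg (t t' : TreeSpace) : 0 ≤ ghDist t t' := by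
  induction t, t' using Quotient.inductionOn₂ with | _ T T' =>
  rw [ghDist_mk]
  refine Real.sInf_nonneg ?_
  rintro r ⟨M, _, φ, φ', -, -, rfl⟩
  exact dist_nonneg.trans (le_max_left _ _)

theorem ghDist_le_of_corr {T T' : RootedTree} {a r : ℝ} (h : Corr T T' a (2 * r)) (hr : 0 < r) :
    ghDist ⟦T⟧ ⟦T'⟧ ≤ r := by
  obtain ⟨v, hv, hvr⟩ := h.exists_ghValues hr
  exact (csInf_le (bddBelow_ghValues T T') hv).trans hvr

theorem hausdorffEDist_range_ne_top (T T' : RootedTree) {M : Type*} [MetricSpace M]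
    {φ : T.carrier → M} {φ' : T'.carrier → M} (hφ : Isometry φ) (hφ' : Isometry φ') :
    Metric.hausdorffEDist (range φ) (range φ') ≠ ⊤ :=
  Metric.hausdorffEDist_ne_top_of_nonempty_of_bounded (range_nonempty _) (range_nonempty _)
    (isCompact_range hφ.continuous).isBounded (isCompact_range hφ'.continuous).isBounded

/-- Points whose images are closer than `r` are related. The images of the roots may themselves be
nearly `r` apart, so distances to the root are only controlled up to `2 * r`; this is the factor 2
between `pinDist` and `ghDist`. -/
theorem corr_of_ghDist_lt {T T' : RootedTree} {r : ℝ} (h : ghDist ⟦T⟧ ⟦T'⟧ < r) :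
    Corr T T' (2 * r) (2 * r) := by
  obtain ⟨v, ⟨M, _, φ, φ', hφ, hφ', rfl⟩, hv⟩ := exists_lt_of_csInf_lt (nonempty_ghValues T T') h
  have hfin := hausdorffEDist_range_ne_top T T' hφ hφ'
  obtain ⟨hv1, hv2⟩ := max_lt_iff.1 hv
  have dis : ∀ x x' y y', dist (φ x) (φ' x') < r → dist (φ y) (φ' y') < r →
      |dist x y - dist x' y'| ≤ 2 * r := by
    intro x x' y y' hx hy
    rw [← hφ.dist_eq, ← hφ'.dist_eq, abs_le]
    have := dist_triangle4 (φ x) (φ' x') (φ' y') (φ y)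
    have := dist_triangle4 (φ' x') (φ x) (φ y) (φ' y')
    rw [dist_comm (φ' y')] at *
    rw [dist_comm (φ' x') (φ x)] at *
    constructor <;> linarith
  refine ⟨fun x x' => dist (φ x) (φ' x') < r, fun x => ?_, fun x' => ?_, hv1, ?_, dis⟩
  · obtain ⟨_, ⟨x', rfl⟩, hx'⟩ := Metric.exists_dist_lt_of_hausdorffDist_lt (mem_range_self x) hv2 hfin
    exact ⟨x', hx'⟩
  · obtain ⟨_, ⟨x, rfl⟩, hx⟩ := Metric.exists_dist_lt_of_hausdorffDist_lt' (mem_range_self x') hv2 hfin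
    exact ⟨x, hx⟩
  · exact fun x x' hx => dis _ _ _ _ hv1 hx

/-- The distance of two trees with the roots kept together, in terms of correspondences. -/
noncomputable def pinDist (t t' : TreeSpace) : ℝ := sInf {r | Corr t.out t'.out r (2 * r)}

theorem bddBelow_pinDist (t t' : TreeSpace) : BddBelow {r | Corr t.out t'.out r (2 * r)} :=
  ⟨0, fun _ h => h.nonneg_left⟩

theorem pinDist_le_of_corr {T T' : RootedTree} {r : ℝ} (h : Corr T T' r (2 * r)) :
    pinDist ⟦T⟧ ⟦T'⟧ ≤ r := by
  refine csInf_le (bddBelow_pinDist _ _) ?_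
  exact ((Corr.out T).symm.trans (h.trans (Corr.out T'))).mono (by simp) (by simp)

theorem corr_of_pinDist_lt {T T' : RootedTree} {r : ℝ} (h : pinDist ⟦T⟧ ⟦T'⟧ < r) :
    Corr T T' r (2 * r) := by
  have hne : {r | Corr (⟦T⟧ : TreeSpace).out (⟦T'⟧ : TreeSpace).out r (2 * r)}.Nonempty := by
    obtain ⟨h, hh⟩ := Corr.dist_root_le (⟦T⟧ : TreeSpace).out
    obtain ⟨h', hh'⟩ := Corr.dist_root_le (⟦T'⟧ : TreeSpace).out
    exact ⟨_, Corr.univ _ _ (fun x => hh ⟨x, rfl⟩) (fun x => hh' ⟨x, rfl⟩)⟩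
  obtain ⟨v, hv, hvr⟩ := exists_lt_of_csInf_lt hne h
  exact ((Corr.out T).trans (hv.trans (Corr.out T').symm)).mono (by simpa using hvr.le)
    (by linarith)

theorem pinDist_nonneg (t t' : TreeSpace) : 0 ≤ pinDist t t' :=
  Real.sInf_nonneg fun _ h => h.nonneg_left

theorem pinDist_self (t : TreeSpace) : pinDist t t = 0 := by
  induction t using Quotient.inductionOn with | _ T =>
  refine le_antisymm (pinDist_le_of_corr ?_) (pinDist_nonneg _ _)
  simpa using Corr.of_equiv (Setoid.refl T)

theorem pinDist_comm (t t' : TreeSpace) : pinDist t t' = pinDist t' t :=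
  congrArg sInf (Set.ext fun _ => ⟨Corr.symm, Corr.symm⟩)

theorem pinDist_triangle (t t' t'' : TreeSpace) :
    pinDist t t'' ≤ pinDist t t' + pinDist t' t'' := by
  induction t, t' using Quotient.inductionOn₂ with | _ T T' =>
  induction t'' using Quotient.inductionOn with | _ T'' =>
  refine le_of_forall_pos_le_add fun ε hε => ?_
  have h := corr_of_pinDist_lt (lt_add_of_pos_right (pinDist ⟦T⟧ ⟦T'⟧) (half_pos hε))
  have h' := corr_of_pinDist_lt (lt_add_of_pos_right (pinDist ⟦T'⟧ ⟦T''⟧) (half_pos hε))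
  exact pinDist_le_of_corr ((h.trans h').mono (by linarith) (by linarith))

theorem ghDist_le_pinDist (t t' : TreeSpace) : ghDist t t' ≤ pinDist t t' := by
  induction t, t' using Quotient.inductionOn₂ with | _ T T' =>
  refine le_of_forall_gt_imp_ge_of_dense fun r hr => ?_
  exact ghDist_le_of_corr (corr_of_pinDist_lt hr) ((pinDist_nonneg _ _).trans_lt hr)

theorem pinDist_le_two_mul_ghDist (t t' : TreeSpace) : pinDist t t' ≤ 2 * ghDist t t' := by
  induction t, t' using Quotient.inductionOn₂ with | _ T T' =>
  refine le_of_forall_pos_le_add fun ε hε => ?_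
  have h := corr_of_ghDist_lt (lt_add_of_pos_right (ghDist ⟦T⟧ ⟦T'⟧) (half_pos hε))
  have := h.nonneg_right
  exact pinDist_le_of_corr (h.mono (by linarith) (by linarith))

/-- This mixed triangle inequality is what makes the balls of `ghDist` open for `pinDist`. -/
theorem ghDist_le_pinDist_add (t t' t'' : TreeSpace) :
    ghDist t t'' ≤ pinDist t t' + ghDist t' t'' := by
  induction t, t' using Quotient.inductionOn₂ with | _ T T' =>
  induction t'' using Quotient.inductionOn with | _ T'' =>
  refine le_of_forall_pos_le_add fun ε hε => ?_
  have h := corr_of_pinDist_lt (lt_add_of_pos_right (pinDist ⟦T⟧ ⟦T'⟧) (half_pos hε))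
  have h' := corr_of_ghDist_lt (lt_add_of_pos_right (ghDist ⟦T'⟧ ⟦T''⟧) (half_pos hε))
  have := ghDist_le_of_corr (r := pinDist ⟦T⟧ ⟦T'⟧ + ghDist ⟦T'⟧ ⟦T''⟧ + ε)
    ((h.trans h').mono le_rfl (by linarith))
    (by linarith [pinDist_nonneg ⟦T⟧ ⟦T'⟧, ghDist_nonneg ⟦T'⟧ ⟦T''⟧])
  linarith

/-- The pseudometric `pinDist`, for its own topology. -/
@[reducible]
noncomputable def pinPseudoMetric : PseudoMetricSpace TreeSpace where
  dist := pinDist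
  dist_self := pinDist_self
  dist_comm := pinDist_comm
  dist_triangle := pinDist_triangle

theorem topology_eq : (inferInstance : TopologicalSpace TreeSpace) =
    pinPseudoMetric.toUniformSpace.toTopologicalSpace := by
  apply le_antisymm
  · intro U hU
    let := pinPseudoMetric
    rw [Metric.isOpen_iff] at hU
    -- The balls of `ghDist` merely generate the topology, so an open set is written as the union of
    -- those it contains. Radius `ε / 2` suffices since `pinDist` is at most twice `ghDist`.
    have : U = ⋃₀ {B | (∃ (t : TreeSpace) (r : ℝ), B = {t' | ghDist t' t < r}) ∧ B ⊆ U} := by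
      apply Subset.antisymm
      · intro t ht
        obtain ⟨ε, hε, h⟩ := hU t ht
        refine ⟨{t' | ghDist t' t < ε / 2}, ⟨⟨t, ε / 2, rfl⟩, fun t' ht' => h ?_⟩, ?_⟩
        · have h1 : ghDist t' t < ε / 2 := ht'
          have h2 := pinDist_le_two_mul_ghDist t' t
          show pinDist t' t < ε
          linarith
        · have := ghDist_le_pinDist t t
          rw [pinDist_self] at this
          show ghDist t t < ε / 2
          linarith
      · exact sUnion_subset fun B hB => hB.2
    rw [this]
    exact TopologicalSpace.GenerateOpen.sUnion _ fun B hB =>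
      TopologicalSpace.GenerateOpen.basic _ hB.1
  · refine le_generateFrom ?_
    rintro _ ⟨t, r, rfl⟩
    let := pinPseudoMetric
    rw [Metric.isOpen_iff]
    intro t' ht'
    have h1 : ghDist t' t < r := ht'
    refine ⟨r - ghDist t' t, sub_pos.2 h1, fun t'' ht'' => ?_⟩
    have h2 : pinDist t'' t' < r - ghDist t' t := ht''
    have := ghDist_le_pinDist_add t'' t' t
    show ghDist t'' t < r
    linarith

/-- The given topology is kept, so the Borel `σ`-algebra of the statement is the one of this
pseudometric. -/
noncomputable instance : PseudoMetricSpace TreeSpace :=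
  pinPseudoMetric.replaceTopology topology_eq

theorem dist_le_of_corr {T T' : RootedTree} {r : ℝ} (h : Corr T T' r (2 * r)) :
    @dist TreeSpace _ ⟦T⟧ ⟦T'⟧ ≤ r := pinDist_le_of_corr h

theorem corr_of_dist_lt {T T' : RootedTree} {r : ℝ} (h : @dist TreeSpace _ ⟦T⟧ ⟦T'⟧ < r) :
    Corr T T' r (2 * r) := corr_of_pinDist_lt h

theorem ghDist_le_dist (t t' : TreeSpace) : ghDist t t' ≤ dist t t' := ghDist_le_pinDist t t'

theorem dist_le_two_mul_ghDist (t t' : TreeSpace) : dist t t' ≤ 2 * ghDist t t' :=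
  pinDist_le_two_mul_ghDist t t'

theorem dist_root_le_height (T : RootedTree) (x : T.carrier) : dist T.root x ≤ height ⟦T⟧ :=
  le_ciSup (Corr.dist_root_le T) x

theorem height_nonneg (t : TreeSpace) : 0 ≤ height t := by
  induction t using Quotient.inductionOn with | _ T =>
  exact Real.iSup_nonneg fun _ => dist_nonneg

theorem height_le {T : RootedTree} {r : ℝ} (h : ∀ x, dist T.root x ≤ r) : height ⟦T⟧ ≤ r :=
  ciSup_le h

theorem height_le_dist_add (t t' : TreeSpace) : height t ≤ dist t t' + height t' := by
  induction t, t' using Quotient.inductionOn₂ with | _ T T' =>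
  refine le_of_forall_pos_le_add fun ε hε => height_le fun x => ?_
  obtain ⟨R, h1, -, -, h4, -⟩ := corr_of_dist_lt (lt_add_of_pos_right (@dist TreeSpace _ ⟦T⟧ ⟦T'⟧) hε)
  obtain ⟨x', hx'⟩ := h1 x
  have := (abs_le.1 (h4 _ _ hx')).2
  linarith [dist_root_le_height T' x']

theorem dist_le_max_height (t t' : TreeSpace) : dist t t' ≤ max (height t) (height t') := by
  induction t, t' using Quotient.inductionOn₂ with | _ T T' =>
  exact dist_le_of_corr (Corr.univ T T' (dist_root_le_height T) (dist_root_le_height T'))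

/-- The class of the one-point tree. -/
def point : TreeSpace := ⟦pointTree⟧

theorem height_point : height point = 0 :=
  le_antisymm (height_le fun x => by rw [Subsingleton.elim (α := PUnit) x pointTree.root, dist_self])
    (height_nonneg _)

/-- Moments of the height thus become $L^p$ distances to the one-point tree. -/
theorem dist_point (t : TreeSpace) : dist t point = height t := by
  apply le_antisymm
  · simpa [height_point, height_nonneg] using dist_le_max_height t point
  · simpa [height_point] using height_le_dist_add t point

theorem continuous_height : Continuous height := by
  have : height = fun t : TreeSpace => dist t point := funext fun t => (dist_point t).symm
  rw [this]
  fun_prop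

end TreeSpace

/-! ### `ℝ`-trees as geodesic spaces with the four-point condition -/

section FourPoint

variable {T : Type*} [MetricSpace T]

/-- `h` restricts to an isometric embedding of `[0, d(a, b)]` that joins `a` to `b`. -/
def IsGeodesic (a b : T) (h : ℝ → T) : Prop :=
  (∀ s ∈ Icc 0 (dist a b), ∀ t ∈ Icc 0 (dist a b), dist (h s) (h t) = |s - t|) ∧
    h 0 = a ∧ h (dist a b) = b

/-- The four-point condition, that is, `0`-hyperbolicity. -/
def FourPoint (T : Type*) [MetricSpace T] : Prop :=
  ∀ a b c e : T, dist b e + dist a c ≤ max (dist b c + dist a e) (dist c e + dist a b)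

theorem IsGeodesic.exists_continuous {a b : T} {h : ℝ → T} (hh : IsGeodesic a b h) :
    ∃ h' : ℝ → T, IsGeodesic a b h' ∧ Continuous h' := by
  have hp : ∀ t, (projIcc 0 (dist a b) dist_nonneg t : ℝ) ∈ Icc 0 (dist a b) := fun t => Subtype.prop _
  have hv : ∀ t (ht : t ∈ Icc 0 (dist a b)), (projIcc 0 (dist a b) dist_nonneg t : ℝ) = t :=
    fun t ht => by rw [projIcc_of_mem _ ht]
  refine ⟨fun t => h (projIcc 0 (dist a b) dist_nonneg t), ⟨fun s hs t ht => ?_, ?_, ?_⟩, ?_⟩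
  · simp only [hv s hs, hv t ht]
    exact hh.1 s hs t ht
  · simp only [hv 0 ⟨le_rfl, dist_nonneg⟩]
    exact hh.2.1
  · simp only [hv _ ⟨dist_nonneg, le_rfl⟩]
    exact hh.2.2
  · have : ContinuousOn h (Icc 0 (dist a b)) := by
      rw [Metric.continuousOn_iff]
      intro s hs ε hε
      exact ⟨ε, hε, fun t ht hts => by rwa [hh.1 t ht s hs, ← Real.dist_eq]⟩
    exact this.comp_continuous (continuous_subtype_val.comp continuous_projIcc) hp

theorem IsGeodesic.dist_left {a b : T} {h : ℝ → T} (hh : IsGeodesic a b h) {t : ℝ}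
    (ht : t ∈ Icc 0 (dist a b)) : dist a (h t) = t := by
  have := hh.1 0 ⟨le_rfl, dist_nonneg⟩ t ht
  rwa [hh.2.1, zero_sub, abs_neg, abs_of_nonneg ht.1] at this

theorem IsGeodesic.dist_right {a b : T} {h : ℝ → T} (hh : IsGeodesic a b h) {t : ℝ}
    (ht : t ∈ Icc 0 (dist a b)) : dist (h t) b = dist a b - t := by
  have := hh.1 t ht _ ⟨dist_nonneg, le_rfl⟩
  rwa [hh.2.2, abs_sub_comm, abs_of_nonneg (sub_nonneg.2 ht.2)] at this

theorem IsRTree.exists_geodesic (hT : IsRTree T) (a b : T) :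
    ∃ h : ℝ → T, IsGeodesic a b h ∧ Continuous h := by
  obtain ⟨h, h1, h2, h3, -⟩ := hT a b
  exact IsGeodesic.exists_continuous ⟨h1, h2, h3⟩

/-- Up to time `t` both geodesics are injective paths from `a` to `f t`, so they have the same
range, and a point of it is determined by its distance to `a`. -/
theorem IsRTree.geodesic_agree (hT : IsRTree T) {a b c : T} {f g : ℝ → T} (hf : IsGeodesic a b f)
    (hfc : Continuous f) (hg : IsGeodesic a c g) (hgc : Continuous g) {t : ℝ}
    (htb : t ∈ Icc 0 (dist a b)) (htc : t ∈ Icc 0 (dist a c)) (hfg : f t = g t) {s : ℝ}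
    (hs : s ∈ Icc 0 t) : f s = g s := by
  rcases hs.1.eq_or_lt with rfl | hs0
  · rw [hf.2.1, hg.2.1]
  have ht0 : 0 < t := hs0.trans_le hs.2
  have hmem : ∀ {d : ℝ}, t ∈ Icc 0 d → ∀ u : unitInterval, (u : ℝ) * t ∈ Icc 0 d := fun ht u =>
    ⟨mul_nonneg u.2.1 ht0.le, (mul_le_of_le_one_left ht0.le u.2.2).trans ht.2⟩
  obtain ⟨h, -, -, -, h4⟩ := hT a (f t)
  have e1 := h4 (fun u => f (u * t)) (by fun_prop) (fun u v huv => by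
      have h1 := hf.dist_left (hmem htb u)
      have h2 := hf.dist_left (hmem htb v)
      simp only at huv
      rw [huv, h2] at h1
      exact Subtype.ext (mul_right_cancel₀ ht0.ne' h1.symm))
    (by simp [hf.2.1]) (by simp)
  have e2 := h4 (fun u => g (u * t)) (by fun_prop) (fun u v huv => by
      have h1 := hg.dist_left (hmem htc u)
      have h2 := hg.dist_left (hmem htc v)
      simp only at huv
      rw [huv, h2] at h1
      exact Subtype.ext (mul_right_cancel₀ ht0.ne' h1.symm))
    (by simp [hg.2.1]) (by simp [hfg])
  have hsu : f s ∈ range fun u : unitInterval => g (u * t) := by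
    rw [e2, ← e1]
    exact ⟨⟨s / t, div_nonneg hs.1 ht0.le, (div_le_one ht0).2 hs.2⟩, by
      simp only; rw [div_mul_cancel₀ _ ht0.ne']⟩
  obtain ⟨u, hu⟩ := hsu
  simp only at hu
  have h1 := hf.dist_left ⟨hs.1, hs.2.trans htb.2⟩
  rw [← hu, hg.dist_left (hmem htc u)] at h1
  rw [← hu, h1]

/-- Two geodesics with the same origin run together and then separate for good. -/
theorem IsRTree.exists_branch_point (hT : IsRTree T) {a b c : T} {f g : ℝ → T}
    (hf : IsGeodesic a b f) (hfc : Continuous f) (hg : IsGeodesic a c g) (hgc : Continuous g) :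
    ∃ t, t ∈ Icc 0 (dist a b) ∧ t ∈ Icc 0 (dist a c) ∧ f t = g t ∧
      dist b c = (dist a b - t) + (dist a c - t) := by
  -- The branch point is at the last time at which the two geodesics agree.
  let A : Set ℝ := Icc 0 (min (dist a b) (dist a c)) ∩ {t | f t = g t}
  have hA : IsCompact A := isCompact_Icc.inter_right (isClosed_eq hfc hgc)
  have hA0 : A.Nonempty :=
    ⟨0, ⟨le_rfl, le_min dist_nonneg dist_nonneg⟩, hf.2.1.trans hg.2.1.symm⟩
  obtain ⟨t, ⟨ht, hfg⟩, hmax⟩ := hA.exists_isGreatest hA0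
  have htb : t ∈ Icc 0 (dist a b) := ⟨ht.1, ht.2.trans (min_le_left _ _)⟩
  have htc : t ∈ Icc 0 (dist a c) := ⟨ht.1, ht.2.trans (min_le_right _ _)⟩
  refine ⟨t, htb, htc, hfg, ?_⟩
  have hfg : f t = g t := hfg
  set x := dist a b - t with hx
  set y := dist a c - t with hy
  have hx0 : 0 ≤ x := sub_nonneg.2 htb.2
  have hy0 : 0 ≤ y := sub_nonneg.2 htc.2
  have eb := hf.dist_right htb
  have ec := hg.dist_right htc
  rw [hfg] at eb
  rcases (add_nonneg hx0 hy0).eq_or_lt with h0 | hpos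
  · have h1 : x = 0 := by linarith
    have h2 : y = 0 := by linarith
    rw [← hx, h1] at eb
    rw [← hy, h2] at ec
    rw [← dist_eq_zero.1 eb, ← dist_eq_zero.1 ec, dist_self, h1, h2, add_zero]
  -- The path goes back from `b` to the branch point along `f` and on to `c` along `g`. Maximality
  -- of `t` makes it injective, so its range is the segment from `b` to `c`, which therefore
  -- contains the branch point.
  let r : ℝ → T := fun v => if v ≤ x then f (dist a b - v) else g (t + (v - x))
  have hrc : Continuous r := by
    refine Continuous.if_le (by fun_prop) (by fun_prop) continuous_id continuous_const ?_
    rintro v rfl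
    rw [sub_self, add_zero, ← hfg]
    congr 1
    simp only [hx]; ring
  have hd1 : ∀ v, 0 ≤ v → v ≤ x → dist a (f (dist a b - v)) = dist a b - v := fun v h1 h2 =>
    hf.dist_left ⟨by linarith [ht.1], by linarith⟩
  have hd2 : ∀ v, x ≤ v → v ≤ x + y → dist a (g (t + (v - x))) = t + (v - x) := fun v h1 h2 =>
    hg.dist_left ⟨by linarith [ht.1], by linarith⟩
  have hcross : ∀ v w, 0 ≤ v → v ≤ x → x < w → w ≤ x + y →
      f (dist a b - v) ≠ g (t + (w - x)) := by
    intro v w h1 h2 h3 h4 he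
    have e1 := hd1 v h1 h2
    have e2 := hd2 w h3.le h4
    rw [he, e2] at e1
    rw [← e1] at he
    have := hmax ⟨⟨by linarith [ht.1], le_min (by linarith) (by linarith)⟩, he⟩
    linarith
  have hri : ∀ v w, 0 ≤ v → v ≤ x + y → 0 ≤ w → w ≤ x + y → r v = r w → v = w := by
    intro v w hv hv' hw hw' he
    simp only [r] at he
    split_ifs at he with h1 h2 h2
    · have e1 := hd1 v hv h1
      have e2 := hd1 w hw h2
      rw [he, e2] at e1
      linarith
    · exact absurd he (hcross v w hv h1 (not_le.1 h2) hw')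
    · exact absurd he.symm (hcross w v hw h2 (not_le.1 h1) hv')
    · have e1 := hd2 v (not_le.1 h1).le hv'
      have e2 := hd2 w (not_le.1 h2).le hw'
      rw [he, e2] at e1
      linarith
  obtain ⟨h, h1, h2, h3, h4⟩ := hT b c
  have hbc : IsGeodesic b c h := ⟨h1, h2, h3⟩
  have hxy : ∀ u : unitInterval, 0 ≤ (u : ℝ) * (x + y) ∧ (u : ℝ) * (x + y) ≤ x + y := fun u =>
    ⟨mul_nonneg u.2.1 hpos.le, mul_le_of_le_one_left hpos.le u.2.2⟩
  have hr := h4 (fun u => r (u * (x + y))) (by fun_prop)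
    (fun u v huv => Subtype.ext (mul_right_cancel₀ hpos.ne'
      (hri _ _ (hxy u).1 (hxy u).2 (hxy v).1 (hxy v).2 huv)))
    (by simp [r, hx0, hf.2.2]) (by
      simp only [Set.Icc.coe_one, one_mul, r]
      split_ifs with hy'
      · have h2 : y = 0 := by linarith
        rw [h2, add_zero, hx, sub_sub_cancel, hfg]
        rw [← hy, h2] at ec
        exact dist_eq_zero.1 ec
      · rw [add_sub_cancel_left, hy, add_sub_cancel, hg.2.2])
  have hm : g t ∈ h '' Icc 0 (dist b c) := by
    rw [← hr]
    refine ⟨⟨x / (x + y), div_nonneg hx0 hpos.le, (div_le_one hpos).2 (by linarith)⟩, ?_⟩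
    simp only
    rw [div_mul_cancel₀ _ hpos.ne']
    simp only [r, le_refl, if_true]
    rw [hx, sub_sub_cancel, hfg]
  obtain ⟨v, hv, hv'⟩ := hm
  have e1 := hbc.dist_left hv
  have e2 := hbc.dist_right hv
  rw [hv'] at e1 e2
  rw [dist_comm] at e1
  linarith

/-- The geodesics from `a` to `b` and `c` share the time up to `t`, those to `c` and `e` the time up
to `t'`. Those to `b` and `e` then agree at time `min t t'`, which bounds `dist b e`; the smaller of
the two times decides which side of the maximum is reached. -/
theorem IsRTree.fourPoint (hT : IsRTree T) : FourPoint T := by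
  intro a b c e
  obtain ⟨f, hf, hfc⟩ := hT.exists_geodesic a b
  obtain ⟨g, hg, hgc⟩ := hT.exists_geodesic a c
  obtain ⟨k, hk, hkc⟩ := hT.exists_geodesic a e
  obtain ⟨t, ht1, ht2, ht3, ht4⟩ := hT.exists_branch_point hf hfc hg hgc
  obtain ⟨t', ht1', ht2', ht3', ht4'⟩ := hT.exists_branch_point hg hgc hk hkc
  have key : ∀ s, s ∈ Icc 0 t → s ∈ Icc 0 t' →
      dist b e ≤ (dist a b - s) + (dist a e - s) := by
    intro s hs hs'
    have e1 := hT.geodesic_agree hf hfc hg hgc ht1 ht2 ht3 hs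
    have e2 := hT.geodesic_agree hg hgc hk hkc ht1' ht2' ht3' hs'
    have e3 := hf.dist_right ⟨hs.1, hs.2.trans ht1.2⟩
    have e4 := hk.dist_right ⟨hs.1, hs'.2.trans ht2'.2⟩
    rw [← e2, ← e1] at e4
    have := dist_triangle_left b e (f s)
    linarith
  rcases le_total t t' with h | h
  · have := key t ⟨ht1.1, le_rfl⟩ ⟨ht1.1, h⟩
    exact le_max_of_le_left (by linarith)
  · have := key t' ⟨ht1'.1, h⟩ ⟨ht1'.1, le_rfl⟩
    exact le_max_of_le_right (by linarith)

/-- The set is the side of `b` when `m` is removed. For `z` inside and `w` outside, the four-point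
condition for `z`, `w`, `m`, `b` has one impossible alternative, and the other says that `m` lies
between `z` and `w`. -/
theorem FourPoint.isCut (hT : FourPoint T) {b m : T} :
    IsCut (insert m {x | dist x b < dist x m + dist m b}) m := by
  refine ⟨mem_insert _ _, fun z hz w hw => ?_⟩
  rcases hz with rfl | hz
  · simp
  have hw' : ¬ dist w b < dist w m + dist m b := fun h => hw (Or.inr h)
  have hz' : dist z b < dist z m + dist m b := hz
  have h4 := hT z w m b
  have h5 : dist w b + dist z m ≤ dist m b + dist z w := by
    rcases le_max_iff.1 h4 with h | h
    · linarith
    · exact h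
  rw [dist_comm m w]
  exact le_antisymm (by rw [dist_comm w m]; exact dist_triangle _ _ _) (by linarith)

/-- Each inner point of the geodesic cuts `a` from `b`, so every path meets it. Conversely, an
injective path is an embedding; the geodesic read through it is a continuous curve in the unit
interval from 0 to 1, hence onto. -/
theorem isRTree_of_fourPoint (hT : FourPoint T) (hg : ∀ a b : T, ∃ h, IsGeodesic a b h) :
    IsRTree T := by
  intro a b
  obtain ⟨h, hh⟩ := hg a b
  refine ⟨h, hh.1, hh.2.1, hh.2.2, fun q hq hi h0 h1 => ?_⟩
  have hsub : ∀ t : Icc 0 (dist a b), ∃ u, q u = h t := by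
    rintro ⟨t, ht⟩
    by_cases hma : h t = a
    · exact ⟨0, h0.trans hma.symm⟩
    by_cases hmb : h t = b
    · exact ⟨1, h1.trans hmb.symm⟩
    have ha : q 0 ∉ insert (h t) {x | dist x b < dist x (h t) + dist (h t) b} := by
      rw [h0]
      rintro (h' | h')
      · exact hma h'.symm
      · have h' : dist a b < dist a (h t) + dist (h t) b := h'
        rw [hh.dist_left ht, hh.dist_right ht] at h'
        linarith
    have hb : q 1 ∈ insert (h t) {x | dist x b < dist x (h t) + dist (h t) b} := by
      rw [h1]
      right
      show dist b b < dist b (h t) + dist (h t) b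
      rw [dist_self]
      have := dist_pos.2 hmb
      have := dist_pos.2 (Ne.symm hmb)
      linarith
    obtain ⟨u, -, -, hu⟩ := hT.isCut.exists_eq hq unitInterval.nonneg' (Or.inr ⟨ha, hb⟩)
    exact ⟨u, hu⟩
  choose g hg' using hsub
  have hgc : Continuous g := by
    rw [(hq.isClosedEmbedding hi).isInducing.continuous_iff]
    have : q ∘ g = fun t : Icc 0 (dist a b) => h t := funext hg'
    rw [this, Metric.continuous_iff]
    exact fun s ε hε => ⟨ε, hε, fun t hts => by
      rwa [hh.1 t t.2 s s.2, ← Real.dist_eq]⟩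
  apply Subset.antisymm
  · rintro _ ⟨u, rfl⟩
    have : PreconnectedSpace (Icc 0 (dist a b)) := Subtype.preconnectedSpace isPreconnected_Icc
    have e0 : g ⟨0, le_rfl, dist_nonneg⟩ = 0 := hi (by rw [hg', h0]; exact hh.2.1)
    have e1 : g ⟨dist a b, dist_nonneg, le_rfl⟩ = 1 := hi (by rw [hg', h1]; exact hh.2.2)
    obtain ⟨t, ht⟩ := intermediate_value_univ ⟨0, le_rfl, dist_nonneg⟩
      ⟨dist a b, dist_nonneg, le_rfl⟩ hgc
      (show u ∈ _ by rw [e0, e1]; exact ⟨unitInterval.nonneg', unitInterval.le_one'⟩)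
    exact ⟨t, t.2, by rw [← hg', ht]⟩
  · rintro _ ⟨t, ht, rfl⟩
    exact ⟨_, hg' ⟨t, ht⟩⟩

/-- A compact space that is approximated by `ℝ`-trees is an `ℝ`-tree. -/
theorem isRTree_of_approx [CompactSpace T]
    (H : ∀ ε > 0, ∃ (Z : Type) (_ : MetricSpace Z) (f : T → Z) (g : Z → T), IsRTree Z ∧
      (∀ x y, |dist (f x) (f y) - dist x y| ≤ ε) ∧ (∀ u v, |dist (g u) (g v) - dist u v| ≤ ε) ∧
      ∀ x, dist (g (f x)) x ≤ ε) : IsRTree T := by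
  apply isRTree_of_fourPoint
  · intro a b c e
    refine le_of_forall_pos_le_add fun ε hε => ?_
    obtain ⟨Z, _, f, g, hZ, hf, -⟩ := H (ε / 4) (by positivity)
    have h4 := hZ.fourPoint (f a) (f b) (f c) (f e)
    have hf' := fun x y => abs_le.1 (hf x y)
    rw [max_add]
    rcases le_max_iff.1 h4 with h | h
    · refine le_max_of_le_left ?_
      linarith [(hf' b e).1, (hf' a c).1, (hf' b c).2, (hf' a e).2]
    · refine le_max_of_le_right ?_
      linarith [(hf' b e).1, (hf' a c).1, (hf' c e).2, (hf' a b).2]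
  · intro a b
    -- Images under `g` of geodesics of the approximating trees, with time cut off at their length
    -- `ℓ`. The factor 3 comes from the endpoint `b`: the cut-off, the distortion of `g` and the
    -- defect of `g ∘ f` cost `ε` each.
    have hγ : ∀ n : ℕ, ∃ γ : ℝ → T,
        (∀ s ∈ Icc 0 (dist a b), ∀ t ∈ Icc 0 (dist a b),
          |dist (γ s) (γ t) - (|s - t|)| ≤ 3 * (1 / (n + 1 : ℝ))) ∧
        dist (γ 0) a ≤ 3 * (1 / (n + 1 : ℝ)) ∧ dist (γ (dist a b)) b ≤ 3 * (1 / (n + 1 : ℝ)) := by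
      intro n
      have hε : 0 < 1 / (n + 1 : ℝ) := by positivity
      set ε := 1 / (n + 1 : ℝ)
      obtain ⟨Z, _, f, g, hZ, hf, hg, hgf⟩ := H ε hε
      obtain ⟨h, hh, -⟩ := hZ.exists_geodesic (f a) (f b)
      set ℓ := dist (f a) (f b) with hℓ
      have hℓ0 : 0 ≤ ℓ := dist_nonneg
      have hfab := abs_le.1 (hf a b)
      have hm : ∀ t ∈ Icc 0 (dist a b), min t ℓ ∈ Icc 0 ℓ := fun t ht =>
        ⟨le_min ht.1 hℓ0, min_le_right _ _⟩
      have hm2 : ∀ t ∈ Icc 0 (dist a b), min t ℓ ≤ t ∧ t - ε ≤ min t ℓ := fun t ht =>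
        ⟨min_le_left _ _, le_min (by linarith) (by linarith [ht.2])⟩
      refine ⟨fun t => g (h (min t ℓ)), fun s hs t ht => ?_, ?_, ?_⟩
      · have h1 := hg (h (min s ℓ)) (h (min t ℓ))
        rw [hh.1 _ (hm s hs) _ (hm t ht)] at h1
        have h2 : |(|min s ℓ - min t ℓ| - |s - t|)| ≤ ε := by
          refine (abs_abs_sub_abs_le_abs_sub _ _).trans ?_
          have := hm2 s hs
          have := hm2 t ht
          rw [abs_le]
          constructor <;> linarith
        have := abs_sub_le (dist (g (h (min s ℓ))) (g (h (min t ℓ)))) (|min s ℓ - min t ℓ|) (|s - t|)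
        simp only
        linarith
      · simp only [min_eq_left hℓ0, hh.2.1]
        linarith [hgf a]
      · have hd : dist a b ∈ Icc 0 (dist a b) := ⟨dist_nonneg, le_rfl⟩
        have h1 := hh.dist_right (hm _ hd)
        have h2 := (abs_le.1 (hg (h (min (dist a b) ℓ)) (f b))).2
        have h3 := dist_triangle (g (h (min (dist a b) ℓ))) (g (f b)) b
        have h4 := hgf b
        have h5 : ℓ - ε ≤ min (dist a b) ℓ := le_min (by linarith) (by linarith)
        simp only
        linarith
    choose γ hγ1 hγ2 hγ3 using hγ
    -- One ultrafilter gives limits at all times at once, without a choice of subsequences.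
    let F : Ultrafilter ℕ := hyperfilter ℕ
    have hF : (F : Filter ℕ) ≤ atTop := Nat.hyperfilter_le_atTop
    have hlim : ∀ t, ∃ x, Tendsto (fun n => γ n t) F (𝓝 x) := fun t => by
      obtain ⟨x, -, hx⟩ := isCompact_iff_ultrafilter_le_nhds.1 (isCompact_univ (X := T))
        (F.map fun n => γ n t) (by simp)
      exact ⟨x, hx⟩
    choose h hh using hlim
    have hε : Tendsto (fun n : ℕ => 3 * (1 / (n + 1 : ℝ))) F (𝓝 0) := by
      have := (tendsto_one_div_add_atTop_nhds_zero_nat (𝕜 := ℝ)).const_mul 3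
      rw [mul_zero] at this
      exact this.mono_left hF
    refine ⟨h, fun s hs t ht => ?_, ?_, ?_⟩
    · have h1 := (((hh s).dist (hh t)).sub_const (|s - t|)).abs
      have := le_of_tendsto_of_tendsto' h1 hε fun n => hγ1 n s hs t ht
      exact sub_eq_zero.1 (abs_eq_zero.1 (le_antisymm this (abs_nonneg _)))
    · have h1 := (hh 0).dist (tendsto_const_nhds (x := a))
      have := le_of_tendsto_of_tendsto' h1 hε fun n => hγ2 n
      exact dist_le_zero.1 this
    · have h1 := (hh (dist a b)).dist (tendsto_const_nhds (x := b))
      have := le_of_tendsto_of_tendsto' h1 hε fun n => hγ3 n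
      exact dist_le_zero.1 this

end FourPoint

/-! ### Separability and completeness of the space of trees -/

namespace TreeSpace

open GromovHausdorff (GHSpace toGHSpace)

/-- The Gromov-Hausdorff class of a tree, without its root. -/
noncomputable def toGH (t : TreeSpace) : GHSpace := toGHSpace t.out.carrier

theorem ghDist_eq_out (t t' : TreeSpace) : ghDist t t' = sInf (ghValues t.out t'.out) :=
  congrArg₂ ghDist (Quotient.out_eq t).symm (Quotient.out_eq t').symm

theorem dist_toGH_le (t t' : TreeSpace) : dist (toGH t) (toGH t') ≤ dist t t' := by
  refine le_trans ?_ (ghDist_le_dist t t')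
  rw [ghDist_eq_out]
  refine le_csInf (nonempty_ghValues _ _) ?_
  rintro _ ⟨M, _, φ, φ', hφ, hφ', rfl⟩
  exact (GromovHausdorff.ghDist_le_hausdorffDist hφ hφ').trans (le_max_right _ _)

section

variable {X : Type} [MetricSpace X] [CompactSpace X] [Nonempty X] {t : TreeSpace} {ε : ℝ}

/-- The point `r` lies next to the root of `t` in an optimal coupling. It does not depend on `r'`,
so the root can afterwards be moved to a point of a dense sequence or to a limit point. -/
theorem exists_root_of_dist_toGH_lt (h : dist (toGH t) (toGHSpace X) < ε) :
    ∃ r : X, ∀ (r' : X) (hX : IsRTree X),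
      @dist TreeSpace _ t ⟦⟨X, r', hX⟩⟧ ≤ 2 * (ε + dist r r') := by
  obtain ⟨φ, ψ, hφ, hψ, he⟩ := GromovHausdorff.ghDist_eq_hausdorffDist t.out.carrier X
  have h' : Metric.hausdorffDist (range φ) (range ψ) < ε := he ▸ h
  have hfin : Metric.hausdorffEDist (range φ) (range ψ) ≠ ⊤ :=
    Metric.hausdorffEDist_ne_top_of_nonempty_of_bounded (range_nonempty _) (range_nonempty _)
      (isCompact_range hφ.continuous).isBounded (isCompact_range hψ.continuous).isBounded
  obtain ⟨_, ⟨r, rfl⟩, hr⟩ := Metric.exists_dist_lt_of_hausdorffDist_lt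
    (mem_range_self t.out.root) h' hfin
  refine ⟨r, fun r' hX => ?_⟩
  refine (dist_le_two_mul_ghDist _ _).trans (mul_le_mul_of_nonneg_left ?_ zero_le_two)
  rw [← Quotient.out_eq t, ghDist_mk]
  refine (csInf_le (bddBelow_ghValues _ _) ⟨_, inferInstance, φ, ψ, hφ, hψ, rfl⟩).trans
    (max_le ?_ ?_)
  · have := dist_triangle (φ t.out.root) (ψ r) (ψ r')
    rw [hψ.dist_eq] at this
    show dist (φ t.out.root) (ψ r') ≤ _
    linarith
  · exact h'.le.trans (le_add_of_nonneg_right dist_nonneg)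

theorem exists_approx_of_dist_toGH_lt (h : dist (toGH t) (toGHSpace X) < ε) :
    ∃ (f : X → t.out.carrier) (g : t.out.carrier → X),
      (∀ x y, |dist (f x) (f y) - dist x y| ≤ 2 * ε) ∧
      (∀ u v, |dist (g u) (g v) - dist u v| ≤ 2 * ε) ∧ ∀ x, dist (g (f x)) x ≤ 2 * ε := by
  obtain ⟨φ, ψ, hφ, hψ, he⟩ := GromovHausdorff.ghDist_eq_hausdorffDist t.out.carrier X
  have h' : Metric.hausdorffDist (range φ) (range ψ) < ε := he ▸ h
  have hfin : Metric.hausdorffEDist (range φ) (range ψ) ≠ ⊤ :=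
    Metric.hausdorffEDist_ne_top_of_nonempty_of_bounded (range_nonempty _) (range_nonempty _)
      (isCompact_range hφ.continuous).isBounded (isCompact_range hψ.continuous).isBounded
  have hg : ∀ u, ∃ x, dist (φ u) (ψ x) < ε := fun u => by
    obtain ⟨_, ⟨x, rfl⟩, hx⟩ := Metric.exists_dist_lt_of_hausdorffDist_lt (mem_range_self u) h' hfin
    exact ⟨x, hx⟩
  have hf : ∀ x, ∃ u, dist (φ u) (ψ x) < ε := fun x => by
    obtain ⟨_, ⟨u, rfl⟩, hu⟩ := Metric.exists_dist_lt_of_hausdorffDist_lt' (mem_range_self x) h' hfin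
    exact ⟨u, hu⟩
  choose g hg using hg
  choose f hf using hf
  refine ⟨f, g, fun x y => ?_, fun u v => ?_, fun x => ?_⟩
  · rw [← hφ.dist_eq, ← hψ.dist_eq, ← Real.dist_eq]
    have := dist_dist_dist_le (φ (f x)) (φ (f y)) (ψ x) (ψ y)
    linarith [hf x, hf y]
  · rw [← hφ.dist_eq, ← hψ.dist_eq, ← Real.dist_eq]
    have := dist_dist_dist_le (ψ (g u)) (ψ (g v)) (φ u) (φ v)
    rw [dist_comm (ψ (g u)) (φ u)] at this
    linarith [hg u, hg v, dist_comm (ψ (g v)) (φ v)]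
  · rw [← hψ.dist_eq]
    have := dist_triangle_left (ψ (g (f x))) (ψ x) (φ (f x))
    linarith [hg (f x), hf x]

end

/-- Countably many unrooted trees, dense in the range of `toGH`, are each rooted at the points of a
dense sequence. -/
instance : TopologicalSpace.SeparableSpace TreeSpace := by
  have : Nonempty (range toGH) := ⟨⟨_, point, rfl⟩⟩
  let u := TopologicalSpace.denseSeq (range toGH)
  choose t ht using fun n => (u n).2
  let w : ℕ × ℕ → TreeSpace := fun k =>
    ⟦⟨(t k.1).out.carrier, TopologicalSpace.denseSeq _ k.2, (t k.1).out.isRTree⟩⟧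
  refine TopologicalSpace.SeparableSpace.of_denseRange w (Metric.dense_iff.2 fun s ε hε => ?_)
  obtain ⟨n, hn⟩ := (TopologicalSpace.denseRange_denseSeq (range toGH)).exists_dist_lt
    ⟨toGH s, s, rfl⟩ (show 0 < ε / 8 by positivity)
  have hn' : dist (toGH s) (toGHSpace (t n).out.carrier) < ε / 8 := by
    have h : dist (toGH s) (u n : GHSpace) < ε / 8 := hn
    rwa [← ht n] at h
  obtain ⟨r, hr⟩ := exists_root_of_dist_toGH_lt hn'
  obtain ⟨k, hk⟩ := (TopologicalSpace.denseRange_denseSeq (t n).out.carrier).exists_dist_lt r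
    (show 0 < ε / 8 by positivity)
  refine ⟨w (n, k), ?_, ⟨_, rfl⟩⟩
  have := hr (TopologicalSpace.denseSeq _ k) (t n).out.isRTree
  rw [Metric.mem_ball, dist_comm]
  exact this.trans_lt (by linarith)

instance : SecondCountableTopology TreeSpace := UniformSpace.secondCountable_of_separable _

/-- The unrooted classes converge in `GHSpace`, and the limit is an `ℝ`-tree by `isRTree_of_approx`.
Points of the limit that approximate the roots converge along a subsequence by compactness, which
suffices for a Cauchy sequence. -/
instance : CompleteSpace TreeSpace := by
  refine Metric.complete_of_cauchySeq_tendsto fun t ht => ?_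
  have hlip : LipschitzWith 1 toGH := LipschitzWith.of_dist_le_mul fun s s' => by
    simpa using dist_toGH_le s s'
  obtain ⟨P, hP⟩ := cauchySeq_tendsto_of_complete (hlip.uniformContinuous.comp_cauchySeq ht)
  rw [← P.toGHSpace_rep] at hP
  have hlim := Metric.tendsto_atTop.1 hP
  have hX : IsRTree P.Rep := by
    refine isRTree_of_approx fun ε hε => ?_
    obtain ⟨N, hN⟩ := hlim (ε / 2) (half_pos hε)
    obtain ⟨f, g, h1, h2, h3⟩ := exists_approx_of_dist_toGH_lt (hN N le_rfl)
    rw [mul_div_cancel₀ _ (two_ne_zero' ℝ)] at h1 h2 h3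
    exact ⟨_, inferInstance, f, g, (t N).out.isRTree, h1, h2, h3⟩
  have hroot : ∀ k : ℕ, ∃ n ≥ k, ∃ r : P.Rep, ∀ (r' : P.Rep) (hX : IsRTree P.Rep),
      @dist TreeSpace _ (t n) ⟦⟨P.Rep, r', hX⟩⟧ ≤ 2 * (1 / (k + 1 : ℝ) + dist r r') := by
    intro k
    obtain ⟨N, hN⟩ := hlim (1 / (k + 1 : ℝ)) (by positivity)
    obtain ⟨r, hr⟩ := exists_root_of_dist_toGH_lt (hN (max N k) (le_max_left _ _))
    exact ⟨max N k, le_max_right _ _, r, hr⟩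
  choose n hn r hr using hroot
  obtain ⟨ρ, -, φ, hφ, hρ⟩ := isCompact_univ.tendsto_subseq (fun k => mem_univ (r k))
  refine ⟨⟦⟨P.Rep, ρ, hX⟩⟧, ?_⟩
  refine tendsto_nhds_of_cauchySeq_of_subseq ht (p := atTop) (f := n ∘ φ)
    (tendsto_atTop_mono (fun k => hn (φ k)) hφ.tendsto_atTop) ?_
  refine tendsto_iff_dist_tendsto_zero.2 (squeeze_zero (fun _ => dist_nonneg)
    (fun k => hr (φ k) ρ hX) ?_)
  have h1 := (tendsto_one_div_add_atTop_nhds_zero_nat (𝕜 := ℝ)).comp hφ.tendsto_atTop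
  have h2 := tendsto_iff_dist_tendsto_zero.1 hρ
  simpa using (h1.add h2).const_mul 2

end TreeSpace

/-! ### Geometry of grafted trees: comparison, compactness, height -/

namespace TreeSpace

theorem height_out (t : TreeSpace) : height ⟦t.out⟧ = height t := congrArg height (Quotient.out_eq t)

theorem dist_root_out_le (t : TreeSpace) (x : t.out.carrier) : dist t.out.root x ≤ height t :=
  (dist_root_le_height _ x).trans_eq (height_out t)

theorem corr_out_of_dist_lt {t t' : TreeSpace} {r : ℝ} (h : dist t t' < r) :
    Corr t.out t'.out r (2 * r) :=
  corr_of_dist_lt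
    ((congrArg₂ (@dist TreeSpace _) (Quotient.out_eq t) (Quotient.out_eq t')).trans_lt h)

theorem exists_dist_root_eq_height (T : RootedTree) : ∃ y, dist T.root y = height ⟦T⟧ := by
  obtain ⟨y, -, hy⟩ := isCompact_univ.exists_isMaxOn (univ_nonempty (α := T.carrier))
    (f := fun y => dist T.root y) (by fun_prop)
  exact ⟨y, le_antisymm (dist_root_le_height T y) (height_le fun x => hy (mem_univ x))⟩

end TreeSpace

open TreeSpace

namespace Graft

variable {β : ℝ} {s s' : GenString} {T T' : ℕ → RootedTree}

/-- The point of the branch below a given point. -/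
def pos : Graft β s T → ℝ
  | base x => x
  | tree i _ => s.loc i

/-- The distance to the branch. -/
noncomputable def hgt : Graft β s T → ℝ
  | base _ => 0
  | tree i y => s.mass i ^ β * dist (T i).root y

theorem pos_mem (g : Graft β s T) : pos g ∈ Icc 0 s.len := by
  rcases g with x | ⟨i, y⟩
  · exact x.2
  · exact s.loc_mem i

theorem hgt_nonneg (g : Graft β s T) : 0 ≤ hgt g := by
  rcases g with x | ⟨i, y⟩
  · exact le_rfl
  · exact mul_nonneg (factor_nonneg β s i) dist_nonneg

theorem graftDist_of_ne {i j : ℕ} (h : i ≠ j) (x : (T i).carrier) (y : (T j).carrier) :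
    graftDist (tree i x : Graft β s T) (tree j y) =
      hgt (tree i x : Graft β s T) + |s.loc i - s.loc j| + hgt (tree j y : Graft β s T) := by
  rw [graftDist_ne h, dist_comm x]
  rfl

theorem graftDist_base_left (x : Icc (0 : ℝ) s.len) (g : Graft β s T) :
    graftDist (base x) g = |(x : ℝ) - pos g| + hgt g := by
  rcases g with y | ⟨i, y⟩
  · exact (add_zero _).symm
  · rfl

theorem graftDist_le (g k : Graft β s T) : graftDist g k ≤ hgt g + |pos g - pos k| + hgt k := by
  rcases g with x | ⟨i, x⟩
  · rw [graftDist_base_left]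
    simp [hgt, pos]
  rcases k with y | ⟨j, y⟩
  · rw [graftDist_comm, graftDist_base_left, abs_sub_comm]
    simp [hgt, pos, add_comm]
  by_cases h : i = j
  · subst h
    rw [graftDist_same]
    simp only [hgt, pos, sub_self, abs_zero, add_zero, ← mul_add]
    exact mul_le_mul_of_nonneg_left (dist_triangle_left _ _ _) (factor_nonneg β s i)
  · exact (graftDist_of_ne h x y).le

/-- Together with `graftDist_le`, this determines the distance up to the height of `k` alone, even
if `g` and `k` lie in the same attached tree. -/
theorem le_graftDist (g k : Graft β s T) : hgt g + |pos g - pos k| - hgt k ≤ graftDist g k := by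
  have hk := hgt_nonneg k
  rcases g with x | ⟨i, x⟩
  · rw [graftDist_base_left, hgt, pos]
    linarith
  rcases k with y | ⟨j, y⟩
  · rw [graftDist_comm, graftDist_base_left, abs_sub_comm]
    simp only [hgt, pos]
    linarith
  by_cases h : i = j
  · subst h
    rw [graftDist_same]
    simp only [hgt, pos, sub_self, abs_zero, add_zero, ← mul_sub]
    refine mul_le_mul_of_nonneg_left ?_ (factor_nonneg β s i)
    linarith [dist_triangle_right (T i).root x y]
  · rw [graftDist_of_ne h x y]
    simp only [pos]
    linarith

/-- Comparison of two grafted trees. The trees `T i` and `T' i` with `i ∈ J` are matched, the others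
are compared with the branch. -/
theorem corr_graftedTree (h : CompactSpace (Grafted β s T)) (h' : CompactSpace (Grafted β s' T'))
    {a b c : ℝ} (ha : 0 ≤ a) (hc : 0 ≤ c) (J : Set ℕ) (hlen : |s.len - s'.len| ≤ b)
    (hloc : ∀ i ∈ J, |s.loc i - s'.loc i| ≤ b)
    (hJ : ∀ i ∈ J, ∃ R : (T i).carrier → (T' i).carrier → Prop,
      (∀ x, ∃ x', R x x') ∧ (∀ x', ∃ x, R x x') ∧
      (∀ x x', R x x' →
        |s.mass i ^ β * dist (T i).root x - s'.mass i ^ β * dist (T' i).root x'| ≤ a) ∧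
      ∀ x x' y y', R x x' → R y y' → |s.mass i ^ β * dist x y - s'.mass i ^ β * dist x' y'| ≤ 2 * a)
    (hJ₁ : ∀ i ∉ J, ∀ x, s.mass i ^ β * dist (T i).root x ≤ c)
    (hJ₂ : ∀ i ∉ J, ∀ x, s'.mass i ^ β * dist (T' i).root x ≤ c) :
    Corr (graftedTree β s T h) (graftedTree β s' T' h') (a + b + c) (2 * (a + b + c)) := by
  have hb : 0 ≤ b := (abs_nonneg _).trans hlen
  choose R hR₁ hR₂ hR₃ hR₄ using hJ
  -- Points are related inside matched trees, or because both are low, of height at most `c`, and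
  -- their positions on the branches are close. Every point of an unmatched tree is low.
  let Rel : Graft β s T → Graft β s' T' → Prop := fun g g' =>
    (∃ i, ∃ hi : i ∈ J, ∃ x x', g = tree i x ∧ g' = tree i x' ∧ R i hi x x') ∨
      (hgt g ≤ c ∧ hgt g' ≤ c ∧ |pos g - pos g'| ≤ b)
  have hlen' := abs_le.1 hlen
  -- the point of the other branch next to a point of the branch
  have near : ∀ t ∈ Icc 0 s.len, ∃ t' ∈ Icc 0 s'.len, |t - t'| ≤ b := by
    intro t ht
    refine ⟨min t s'.len, ⟨le_min ht.1 ?_, min_le_right _ _⟩, ?_⟩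
    · exact (s'.loc_mem 0).1.trans (s'.loc_mem 0).2
    · rw [abs_of_nonneg (sub_nonneg.2 (min_le_left _ _))]
      rcases min_cases t s'.len with hm | hm <;> linarith [hm.1, ht.2]
  have near' : ∀ t' ∈ Icc 0 s'.len, ∃ t ∈ Icc 0 s.len, |t - t'| ≤ b := by
    intro t' ht
    refine ⟨min t' s.len, ⟨le_min ht.1 ?_, min_le_right _ _⟩, ?_⟩
    · exact (s.loc_mem 0).1.trans (s.loc_mem 0).2
    · rw [abs_sub_comm, abs_of_nonneg (sub_nonneg.2 (min_le_left _ _))]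
      rcases min_cases t' s.len with hm | hm <;> linarith [hm.1, ht.2]
  have tot : ∀ g, ∃ g', Rel g g' := by
    rintro (x | ⟨i, x⟩)
    · obtain ⟨t', ht', htt'⟩ := near x x.2
      exact ⟨base ⟨t', ht'⟩, Or.inr ⟨hc, hc, htt'⟩⟩
    · by_cases hi : i ∈ J
      · obtain ⟨x', hx'⟩ := hR₁ i hi x
        exact ⟨tree i x', Or.inl ⟨i, hi, x, x', rfl, rfl, hx'⟩⟩
      · obtain ⟨t', ht', htt'⟩ := near _ (s.loc_mem i)
        exact ⟨base ⟨t', ht'⟩, Or.inr ⟨hJ₁ i hi x, hc, htt'⟩⟩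
  have tot' : ∀ g', ∃ g, Rel g g' := by
    rintro (x | ⟨i, x⟩)
    · obtain ⟨t', ht', htt'⟩ := near' x x.2
      exact ⟨base ⟨t', ht'⟩, Or.inr ⟨hc, hc, htt'⟩⟩
    · by_cases hi : i ∈ J
      · obtain ⟨x', hx'⟩ := hR₂ i hi x
        exact ⟨tree i x', Or.inl ⟨i, hi, x', x, rfl, rfl, hx'⟩⟩
      · obtain ⟨t', ht', htt'⟩ := near' _ (s'.loc_mem i)
        exact ⟨base ⟨t', ht'⟩, Or.inr ⟨hc, hJ₂ i hi x, htt'⟩⟩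
  have relpos : ∀ g g', Rel g g' → |pos g - pos g'| ≤ b := by
    rintro g g' (⟨i, hi, x, x', rfl, rfl, -⟩ | ⟨-, -, h⟩)
    · exact hloc i hi
    · exact h
  have relhgt : ∀ g g', Rel g g' → |hgt g - hgt g'| ≤ a + c := by
    rintro g g' (⟨i, hi, x, x', rfl, rfl, hx⟩ | ⟨h1, h2, -⟩)
    · exact (hR₃ i hi x x' hx).trans (le_add_of_nonneg_right hc)
    · rw [abs_le]
      constructor <;> linarith [hgt_nonneg g, hgt_nonneg g']
  have posdiff : ∀ g g' k k', Rel g g' → Rel k k' →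
      |(|pos g - pos k| - |pos g' - pos k'|)| ≤ 2 * b := by
    intro g g' k k' hg hk
    refine (abs_abs_sub_abs_le_abs_sub _ _).trans ?_
    have := abs_le.1 (relpos g g' hg)
    have := abs_le.1 (relpos k k' hk)
    rw [abs_le]
    constructor <;> linarith
  have mixed : ∀ g g' k k', Rel g g' → hgt k ≤ c → hgt k' ≤ c → Rel k k' →
      |graftDist g k - graftDist g' k'| ≤ 2 * (a + b + c) := by
    intro g g' k k' hg hk hk' hkk
    have h1 := abs_le.1 (relhgt g g' hg)
    have h2 := abs_le.1 (posdiff g g' k k' hg hkk)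
    have h5 := hgt_nonneg k
    have h6 := hgt_nonneg k'
    rcases hg with ⟨i, hi, x, x', rfl, rfl, hx⟩ | ⟨h7, h8, -⟩
    · have h9 := abs_le.1 (hR₃ i hi x x' hx)
      change -a ≤ hgt (tree i x : Graft β s T) - hgt (tree i x' : Graft β s' T') ∧
        hgt (tree i x : Graft β s T) - hgt (tree i x' : Graft β s' T') ≤ a at h9
      rw [abs_le]
      constructor
      · linarith [le_graftDist (tree i x : Graft β s T) k,
          graftDist_le (tree i x' : Graft β s' T') k']
      · linarith [graftDist_le (tree i x : Graft β s T) k,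
          le_graftDist (tree i x' : Graft β s' T') k']
    · have h9 := hgt_nonneg g
      have h10 := hgt_nonneg g'
      -- The average of `e1` and `e2` bounds the distance below by the distance of the positions;
      -- likewise `e3` and `e4`.
      have e1 := le_graftDist g k
      have e2 := le_graftDist k g
      have e3 := le_graftDist g' k'
      have e4 := le_graftDist k' g'
      rw [graftDist_comm k, abs_sub_comm] at e2
      rw [graftDist_comm k', abs_sub_comm] at e4
      rw [abs_le]
      constructor
      · linarith [graftDist_le g' k']
      · linarith [graftDist_le g k]
  have dis : ∀ g g' k k', Rel g g' → Rel k k' →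
      |graftDist g k - graftDist g' k'| ≤ 2 * (a + b + c) := by
    intro g g' k k' hg hk
    have hp := posdiff g g' k k' hg hk
    rcases hk with ⟨j, hj, y, y', rfl, rfl, hy⟩ | ⟨h1, h2, h3⟩
    · rcases hg with ⟨i, hi, x, x', rfl, rfl, hx⟩ | ⟨h1, h2, h3⟩
      · by_cases hij : i = j
        · subst hij
          rw [graftDist_same, graftDist_same]
          exact (hR₄ i hi x x' y y' hx hy).trans (by linarith)
        -- The errors `a` at the two roots add up to `2 * a`, which is what the two distortion
        -- bounds in `Corr` allow.
        · rw [graftDist_of_ne hij, graftDist_of_ne hij]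
          have hx' := abs_le.1 (hR₃ i hi x x' hx)
          have hy' := abs_le.1 (hR₃ j hj y y' hy)
          have hp := abs_le.1 hp
          simp only [pos] at hp
          simp only [hgt]
          rw [abs_le]
          constructor <;> linarith
      · rw [graftDist_comm, graftDist_comm g']
        exact mixed _ _ _ _ (Or.inl ⟨j, hj, y, y', rfl, rfl, hy⟩) h1 h2 (Or.inr ⟨h1, h2, h3⟩)
    · exact mixed _ _ _ _ hg h1 h2 (Or.inr ⟨h1, h2, h3⟩)
  refine ⟨fun z z' => ∃ g g', SeparationQuotient.mk g = z ∧ SeparationQuotient.mk g' = z' ∧ Rel g g',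
    fun z => ?_, fun z' => ?_, ⟨_, _, rfl, rfl, Or.inr ⟨hc, hc, by simpa [pos] using hb⟩⟩, ?_, ?_⟩
  · obtain ⟨g, rfl⟩ := SeparationQuotient.surjective_mk z
    obtain ⟨g', hg'⟩ := tot g
    exact ⟨_, g, g', rfl, rfl, hg'⟩
  · obtain ⟨g', rfl⟩ := SeparationQuotient.surjective_mk z'
    obtain ⟨g, hg⟩ := tot' g'
    exact ⟨_, g, g', rfl, rfl, hg⟩
  · rintro _ _ ⟨g, g', rfl, rfl, hg⟩
    show |dist (SeparationQuotient.mk _) (SeparationQuotient.mk g) -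
      dist (SeparationQuotient.mk _) (SeparationQuotient.mk g')| ≤ _
    rw [dist_mk, dist_mk, graftDist_base_left, graftDist_base_left]
    have h1 := abs_le.1 (relhgt g g' hg)
    have h2 := abs_le.1 (relpos g g' hg)
    simp only [zero_sub, abs_neg]
    rw [abs_of_nonneg (pos_mem g).1, abs_of_nonneg (pos_mem g').1, abs_le]
    constructor <;> linarith
  · rintro _ _ _ _ ⟨g, g', rfl, rfl, hg⟩ ⟨k, k', rfl, rfl, hk⟩
    show |dist (SeparationQuotient.mk g) (SeparationQuotient.mk k) -
      dist (SeparationQuotient.mk g') (SeparationQuotient.mk k')| ≤ _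
    rw [dist_mk, dist_mk]
    exact dis g g' k k' hg hk

theorem continuous_tree (i : ℕ) : Continuous (tree i : (T i).carrier → Graft β s T) := by
  have h0 := factor_nonneg β s i
  refine LipschitzWith.continuous (K := ⟨s.mass i ^ β, h0⟩) (LipschitzWith.of_dist_le_mul ?_)
  intro x y
  rw [dist_eq, graftDist_same]
  rfl

/-- An ultrafilter either contains one attached tree, which is compact, or leaves every finite set
of them. In the second case the heights over the branch tend to 0 along it, and it converges to the
limit of its positions. -/
theorem compactSpace (h : Tendsto (fun i => s.mass i ^ β * height ⟦T i⟧) atTop (𝓝 0)) :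
    CompactSpace (Grafted β s T) := by
  suffices CompactSpace (Graft β s T) from
    isCompact_univ_iff.1 (by
      have := isCompact_range (SeparationQuotient.continuous_mk (X := Graft β s T))
      rwa [SeparationQuotient.surjective_mk.range_eq] at this)
  rw [← isCompact_univ_iff, isCompact_iff_ultrafilter_le_nhds]
  intro F _
  by_cases hF : ∃ i, range (tree i : (T i).carrier → Graft β s T) ∈ F
  · obtain ⟨i, hi⟩ := hF
    obtain ⟨x, hx, hFx⟩ := isCompact_iff_ultrafilter_le_nhds.1
      (isCompact_range (continuous_tree (β := β) (s := s) (T := T) i)) F (le_principal_iff.2 hi)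
    exact ⟨x, mem_univ _, hFx⟩
  · push Not at hF
    obtain ⟨x, hx, hFx⟩ := isCompact_iff_ultrafilter_le_nhds.1 (isCompact_Icc (a := 0) (b := s.len))
      (F.map pos) (le_principal_iff.2 (Filter.mem_map.2 (Filter.univ_mem' pos_mem)))
    refine ⟨base ⟨x, hx⟩, mem_univ _, ?_⟩
    have h1 : Tendsto (pos : Graft β s T → ℝ) F (𝓝 x) := hFx
    have h2 : Tendsto (hgt : Graft β s T → ℝ) F (𝓝 0) := by
      rw [Metric.tendsto_nhds]
      intro ε hε
      obtain ⟨N, hN⟩ := eventually_atTop.1 (h.eventually (gt_mem_nhds hε))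
      have h3 : ∀ᶠ g in (F : Filter (Graft β s T)), ∀ i ∈ Finset.range N,
          g ∉ range (tree i : (T i).carrier → Graft β s T) :=
        (Finset.eventually_all _).2 fun i _ => Ultrafilter.compl_mem_iff_notMem.2 (hF i)
      filter_upwards [h3] with g hg
      rw [Real.dist_eq, sub_zero, abs_of_nonneg (hgt_nonneg g)]
      rcases g with y | ⟨i, y⟩
      · exact hε
      · have hi : N ≤ i := by
          by_contra hi
          exact hg i (Finset.mem_range.2 (not_le.1 hi)) ⟨y, rfl⟩
        exact (mul_le_mul_of_nonneg_left (dist_root_le_height _ _) (factor_nonneg β s i)).trans_lt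
          (hN i hi)
    show Tendsto id (F : Filter (Graft β s T)) _
    rw [tendsto_iff_dist_tendsto_zero]
    have h4 : Tendsto (fun g : Graft β s T => |x - pos g| + hgt g) F (𝓝 0) := by
      simpa using ((h1.const_sub x).abs).add h2
    refine h4.congr fun g => ?_
    rw [id, dist_comm, dist_eq, graftDist_base_left]

/-- Otherwise the highest points of infinitely many attached trees would be `ε`-separated. -/
theorem tendsto_of_compactSpace (h : CompactSpace (Grafted β s T)) :
    Tendsto (fun i => s.mass i ^ β * height ⟦T i⟧) atTop (𝓝 0) := by
  by_contra hn
  have h0 : ∀ i, 0 ≤ s.mass i ^ β * height ⟦T i⟧ := fun i =>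
    mul_nonneg (factor_nonneg β s i) (height_nonneg _)
  obtain ⟨ε, hε, hf⟩ : ∃ ε > 0, ∃ᶠ i in atTop, ε ≤ s.mass i ^ β * height ⟦T i⟧ := by
    by_contra! hc
    refine hn (Metric.tendsto_nhds.2 fun ε hε => ?_)
    filter_upwards [hc ε hε] with i hi
    rw [Real.dist_eq, sub_zero, abs_of_nonneg (h0 i)]
    exact hi
  obtain ⟨φ, hφ, hφε⟩ := extraction_of_frequently_atTop hf
  choose y hy using fun i => exists_dist_root_eq_height (T i)
  obtain ⟨z, ψ, hψ, hz⟩ := CompactSpace.tendsto_subseq fun n =>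
    (SeparationQuotient.mk (tree (φ n) (y (φ n))) : Grafted β s T)
  obtain ⟨N, hN⟩ := Metric.cauchySeq_iff.1 hz.cauchySeq ε hε
  have hd := hN N le_rfl (N + 1) (Nat.le_succ N)
  have hne : φ (ψ N) ≠ φ (ψ (N + 1)) := (hφ (hψ (Nat.lt_succ_self N))).ne
  simp only [Function.comp, dist_mk] at hd
  rw [graftDist_of_ne hne] at hd
  simp only [hgt, hy] at hd
  linarith [hφε (ψ N), h0 (φ (ψ (N + 1))), abs_nonneg (s.loc (φ (ψ N)) - s.loc (φ (ψ (N + 1))))]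

theorem height_graftedTree_le (h : CompactSpace (Grafted β s T)) {c : ℝ} (hc : 0 ≤ c)
    (hT : ∀ i, s.mass i ^ β * height ⟦T i⟧ ≤ c) :
    height ⟦graftedTree β s T h⟧ ≤ s.len + c := by
  refine height_le fun z => ?_
  obtain ⟨g, rfl⟩ := SeparationQuotient.surjective_mk z
  show dist (SeparationQuotient.mk _) (SeparationQuotient.mk g) ≤ _
  rw [dist_mk, graftDist_base_left]
  simp only [zero_sub, abs_neg]
  rw [abs_of_nonneg (pos_mem g).1]
  refine add_le_add (pos_mem g).2 ?_
  rcases g with x | ⟨i, x⟩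
  · exact hc
  · exact (mul_le_mul_of_nonneg_left (dist_root_le_height _ _) (factor_nonneg β s i)).trans (hT i)

end Graft

/-! ### Distance estimates for the grafting map -/

section GraftMap

variable {β : ℝ} {s s' : GenString} {τ τ' : ℕ → TreeSpace}

/-- The heights of the rescaled trees tend to `0`, that is, the grafted tree is compact. -/
def Graftable (β : ℝ) (s : GenString) (τ : ℕ → TreeSpace) : Prop :=
  Tendsto (fun i => s.mass i ^ β * height (τ i)) atTop (𝓝 0)

theorem graftable_iff : Graftable β s τ ↔ CompactSpace (Grafted β s fun i => (τ i).out) := by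
  have : (fun i => s.mass i ^ β * height (τ i)) =
      fun i => s.mass i ^ β * height ⟦(τ i).out⟧ := funext fun i => by rw [height_out]
  rw [Graftable, this]
  exact ⟨Graft.compactSpace, Graft.tendsto_of_compactSpace⟩

theorem graftMap_of_graftable (h : Graftable β s τ) :
    graftMap β s τ = ⟦graftedTree β s (fun i => (τ i).out) (graftable_iff.1 h)⟧ :=
  dif_pos (graftable_iff.1 h)

theorem graftMap_of_not_graftable (h : ¬ Graftable β s τ) : graftMap β s τ = point :=
  dif_neg (graftable_iff.not.1 h)

theorem height_graftMap_le (h : Graftable β s τ) {c : ℝ} (hc : 0 ≤ c)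
    (hT : ∀ i, s.mass i ^ β * height (τ i) ≤ c) : height (graftMap β s τ) ≤ s.len + c := by
  rw [graftMap_of_graftable h]
  exact Graft.height_graftedTree_le _ hc fun i => by rw [height_out]; exact hT i

theorem dist_graftMap_le (h : Graftable β s τ) (h' : Graftable β s' τ') {a b c : ℝ} (ha : 0 ≤ a)
    (hc : 0 ≤ c) (J : Set ℕ) (hlen : |s.len - s'.len| ≤ b)
    (hloc : ∀ i ∈ J, |s.loc i - s'.loc i| ≤ b)
    (hJ : ∀ i ∈ J, s'.mass i ^ β * dist (τ i) (τ' i) +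
      |s.mass i ^ β - s'.mass i ^ β| * height (τ i) < a)
    (hJ₁ : ∀ i ∉ J, s.mass i ^ β * height (τ i) ≤ c)
    (hJ₂ : ∀ i ∉ J, s'.mass i ^ β * height (τ' i) ≤ c) :
    dist (graftMap β s τ) (graftMap β s' τ') ≤ a + b + c := by
  rw [graftMap_of_graftable h, graftMap_of_graftable h']
  refine dist_le_of_corr (Graft.corr_graftedTree _ _ ha hc J hlen hloc (fun i hi => ?_)
    (fun i hi x => ?_) (fun i hi x => ?_))
  · set m := s.mass i ^ β
    set m' := s'.mass i ^ β
    have hm' : 0 ≤ m' := Graft.factor_nonneg β s' i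
    -- The distance is an infimum, so a correspondence exists only for `r` strictly above it; the
    -- strict bound `hJ` leaves room. If `m' = 0`, any such `r` will do.
    obtain ⟨r, hr, hra⟩ : ∃ r, dist (τ i) (τ' i) < r ∧ m' * r + |m - m'| * height (τ i) ≤ a := by
      rcases hm'.eq_or_lt with h0 | hpos
      · refine ⟨_, lt_add_one _, ?_⟩
        have : m' * dist (τ i) (τ' i) + |m - m'| * height (τ i) < a := hJ i hi
        rw [← h0, zero_mul] at this
        rw [← h0, zero_mul]
        exact this.le
      · refine ⟨(a - |m - m'| * height (τ i)) / m', ?_, ?_⟩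
        · rw [lt_div_iff₀ hpos]
          linarith [hJ i hi]
        · rw [mul_div_cancel₀ _ hpos.ne']
          linarith
    obtain ⟨R, h1, h2, -, h3, h4⟩ := corr_out_of_dist_lt hr
    have key : ∀ u v w z : ℝ, |u - v| ≤ w → 0 ≤ u → u ≤ z →
        |m * u - m' * v| ≤ m' * w + |m - m'| * z := by
      intro u v w z huv hu huz
      have e : m * u - m' * v = m' * (u - v) + (m - m') * u := by ring
      rw [e]
      refine (abs_add_le _ _).trans ?_
      rw [abs_mul, abs_mul, abs_of_nonneg hm', abs_of_nonneg hu]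
      gcongr
    refine ⟨R, h1, h2, fun x x' hx => ?_, fun x x' y y' hx hy => ?_⟩
    · exact (key _ _ _ _ (h3 x x' hx) dist_nonneg (dist_root_out_le _ _)).trans hra
    · have hd : dist x y ≤ 2 * height (τ i) := by
        have := dist_triangle_left x y (τ i).out.root
        linarith [dist_root_out_le _ x, dist_root_out_le _ y]
      exact (key _ _ _ _ (h4 x x' y y' hx hy) dist_nonneg hd).trans (by linarith)
  · exact (mul_le_mul_of_nonneg_left (dist_root_out_le _ x) (Graft.factor_nonneg β s i)).trans
      (hJ₁ i hi)
  · exact (mul_le_mul_of_nonneg_left (dist_root_out_le _ x) (Graft.factor_nonneg β s' i)).trans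
      (hJ₂ i hi)

theorem dist_graftMap_le_of_forall (h : Graftable β s τ) (h' : Graftable β s τ') {r : ℝ} (hr : 0 ≤ r)
    (H : ∀ i, s.mass i ^ β * dist (τ i) (τ' i) ≤ r) :
    dist (graftMap β s τ) (graftMap β s τ') ≤ r := by
  refine le_of_forall_pos_le_add fun ε hε => ?_
  have := dist_graftMap_le h h' (a := r + ε) (b := 0) (c := 0) (by positivity) le_rfl univ
    (by simp) (by simp) (fun i _ => by simpa using (H i).trans_lt (lt_add_of_pos_right r hε))
    (by simp) (by simp)
  simpa using this

end GraftMap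

open TreeSpace

/-! ### Measurability of the grafting map -/

namespace GenString

theorem measurable_data : Measurable fun s : GenString => (s.len, s.loc, s.mass) :=
  comap_measurable _

theorem measurable_len : Measurable len := measurable_fst.comp measurable_data

theorem measurable_mass (i : ℕ) : Measurable fun s : GenString => s.mass i :=
  (measurable_pi_apply i).comp (measurable_snd.comp (measurable_snd.comp measurable_data))

theorem len_nonneg (s : GenString) : 0 ≤ s.len := (s.loc_mem 0).1.trans (s.loc_mem 0).2

/-- The topology of componentwise convergence. -/
instance : TopologicalSpace GenString :=
  TopologicalSpace.induced (fun s => (s.len, s.loc, s.mass)) inferInstance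

theorem isInducing_data :
    Topology.IsInducing fun s : GenString => (s.len, s.loc, s.mass) := ⟨rfl⟩

theorem continuous_data : Continuous fun s : GenString => (s.len, s.loc, s.mass) :=
  isInducing_data.continuous

theorem continuous_len : Continuous len := continuous_fst.comp continuous_data

theorem continuous_loc (i : ℕ) : Continuous fun s : GenString => s.loc i :=
  (continuous_apply i).comp (continuous_fst.comp (continuous_snd.comp continuous_data))

theorem continuous_mass (i : ℕ) : Continuous fun s : GenString => s.mass i :=
  (continuous_apply i).comp (continuous_snd.comp (continuous_snd.comp continuous_data))

instance : SecondCountableTopology GenString := isInducing_data.secondCountableTopology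

instance : BorelSpace GenString := ⟨by
  have h : borel GenString = MeasurableSpace.comap (fun s : GenString => (s.len, s.loc, s.mass))
    (borel (ℝ × (ℕ → ℝ) × (ℕ → ℝ))) := borel_comap
  rw [h, ← BorelSpace.measurable_eq]
  rfl⟩

/-- The string with only its first `n` atoms. -/
noncomputable def trunc (n : ℕ) (s : GenString) : GenString where
  len := s.len
  loc := s.loc
  mass i := if i < n then s.mass i else 0
  loc_mem := s.loc_mem
  mass_nonneg i := by
    split_ifs
    · exact s.mass_nonneg i
    · exact le_rfl

end GenString

open GenString

variable {β : ℝ}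

theorem trunc_mass_rpow_of_lt (s : GenString) {n i : ℕ} (hi : i < n) :
    (s.trunc n).mass i ^ β = s.mass i ^ β := by simp [trunc, hi]

theorem trunc_mass_rpow_of_le (hβ : 0 < β) (s : GenString) {n i : ℕ} (hi : n ≤ i) :
    (s.trunc n).mass i ^ β = 0 := by simp [trunc, not_lt.2 hi, Real.zero_rpow hβ.ne']

theorem graftable_trunc (hβ : 0 < β) (n : ℕ) (s : GenString) (τ : ℕ → TreeSpace) :
    Graftable β (s.trunc n) τ := by
  refine tendsto_const_nhds.congr' ?_
  filter_upwards [eventually_ge_atTop n] with i hi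
  rw [trunc_mass_rpow_of_le hβ s hi, zero_mul]

theorem tendsto_graftMap_trunc (hβ : 0 < β) {s : GenString} {τ : ℕ → TreeSpace}
    (h : Graftable β s τ) :
    Tendsto (fun n => graftMap β (s.trunc n) τ) atTop (𝓝 (graftMap β s τ)) := by
  rw [Metric.tendsto_atTop]
  intro ε hε
  obtain ⟨N, hN⟩ := eventually_atTop.1 (h.eventually (gt_mem_nhds (show 0 < ε / 3 by positivity)))
  refine ⟨N, fun n hn => ?_⟩
  have := dist_graftMap_le (graftable_trunc hβ n s τ) h (a := ε / 3) (b := 0) (c := ε / 3)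
    (by positivity) (by positivity) {i | i < n} (by simp [trunc]) (by simp [trunc])
    (fun i hi => by simp [trunc_mass_rpow_of_lt s hi]; positivity)
    (fun i hi => by
      simp only [trunc_mass_rpow_of_le hβ s (not_lt.1 hi), zero_mul]
      positivity)
    (fun i hi => (hN i (hn.trans (not_lt.1 hi))).le)
  linarith

/-- Only finitely many atoms matter, so the distance is bounded by a finite sum that is continuous
and vanishes at the base point. -/
theorem continuous_graftMap_trunc (hβ : 0 < β) (n : ℕ) :
    Continuous fun z : GenString × (ℕ → TreeSpace) => graftMap β (z.1.trunc n) z.2 := by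
  rw [continuous_iff_continuousAt]
  intro z
  have cm : ∀ i, Continuous fun w : GenString × (ℕ → TreeSpace) => w.1.mass i ^ β := fun i =>
    ((continuous_mass i).comp continuous_fst).rpow_const fun _ => Or.inr hβ.le
  have cl : ∀ i, Continuous fun w : GenString × (ℕ → TreeSpace) => w.1.loc i := fun i =>
    (continuous_loc i).comp continuous_fst
  have cL : Continuous fun w : GenString × (ℕ → TreeSpace) => w.1.len :=
    continuous_len.comp continuous_fst
  let A : GenString × (ℕ → TreeSpace) → ℝ := fun w => ∑ i ∈ Finset.range n,
    (w.1.mass i ^ β * dist (z.2 i) (w.2 i) + |z.1.mass i ^ β - w.1.mass i ^ β| * height (z.2 i))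
  let B : GenString × (ℕ → TreeSpace) → ℝ := fun w =>
    |z.1.len - w.1.len| + ∑ i ∈ Finset.range n, |z.1.loc i - w.1.loc i|
  have hA : Continuous A := by fun_prop
  have hB : Continuous B := by fun_prop
  have hA0 : A z = 0 := by simp [A]
  have hB0 : B z = 0 := by simp [B]
  have hAi : ∀ (w : GenString × (ℕ → TreeSpace)) (i : ℕ), 0 ≤ w.1.mass i ^ β * dist (z.2 i) (w.2 i) +
      |z.1.mass i ^ β - w.1.mass i ^ β| * height (z.2 i) := fun w i =>
    add_nonneg (mul_nonneg (Graft.factor_nonneg β _ i) dist_nonneg)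
      (mul_nonneg (abs_nonneg _) (height_nonneg _))
  have key : ∀ w : GenString × (ℕ → TreeSpace), dist (graftMap β (w.1.trunc n) w.2) (graftMap β (z.1.trunc n) z.2) ≤ A w + B w := by
    intro w
    refine le_of_forall_pos_le_add fun ε hε => ?_
    rw [dist_comm]
    have := dist_graftMap_le (graftable_trunc hβ n z.1 z.2) (graftable_trunc hβ n w.1 w.2)
      (a := A w + ε) (b := B w) (c := 0)
      (add_nonneg (Finset.sum_nonneg fun i _ => hAi w i) hε.le) le_rfl {i | i < n}
      (le_add_of_nonneg_right (Finset.sum_nonneg fun i _ => abs_nonneg _))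
      (fun i hi => le_add_of_nonneg_of_le (abs_nonneg _)
        (Finset.single_le_sum (f := fun i => |z.1.loc i - w.1.loc i|) (fun i _ => abs_nonneg _)
          (Finset.mem_range.2 hi)))
      (fun i hi => by
        rw [trunc_mass_rpow_of_lt _ hi, trunc_mass_rpow_of_lt _ hi]
        exact (Finset.single_le_sum (f := fun i => w.1.mass i ^ β * dist (z.2 i) (w.2 i) +
          |z.1.mass i ^ β - w.1.mass i ^ β| * height (z.2 i)) (fun i _ => hAi w i)
          (Finset.mem_range.2 hi)).trans_lt (lt_add_of_pos_right _ hε))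
      (fun i hi => by rw [trunc_mass_rpow_of_le hβ _ (not_lt.1 hi), zero_mul])
      (fun i hi => by rw [trunc_mass_rpow_of_le hβ _ (not_lt.1 hi), zero_mul])
    linarith
  refine tendsto_iff_dist_tendsto_zero.2 (squeeze_zero (fun _ => dist_nonneg) key ?_)
  have := (hA.add hB).tendsto z
  rwa [Pi.add_apply, hA0, hB0, add_zero] at this

theorem measurableSet_graftable :
    MeasurableSet {z : GenString × (ℕ → TreeSpace) | Graftable β z.1 z.2} := by
  refine measurableSet_tendsto (𝓝 0) fun i => ?_
  have h1 : Measurable fun z : GenString × (ℕ → TreeSpace) => z.1.mass i :=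
    (measurable_mass i).comp measurable_fst
  have h2 : Measurable fun z : GenString × (ℕ → TreeSpace) => height (z.2 i) :=
    continuous_height.measurable.comp ((measurable_pi_apply i).comp measurable_snd)
  exact (h1.pow_const β).mul h2

/-- On the measurable set where the tree is compact, the map is the limit of the continuous maps for
truncated strings; elsewhere it is constant. -/
theorem measurable_graftMap (hβ : 0 < β) :
    Measurable fun z : GenString × (ℕ → TreeSpace) => graftMap β z.1 z.2 := by
  classical
  let F : ℕ → GenString × (ℕ → TreeSpace) → TreeSpace := fun n z =>
    if Graftable β z.1 z.2 then graftMap β (z.1.trunc n) z.2 else point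
  have hF : ∀ n, Measurable (F n) := fun n =>
    Measurable.ite (p := fun z : GenString × (ℕ → TreeSpace) => Graftable β z.1 z.2)
      measurableSet_graftable (continuous_graftMap_trunc hβ n).measurable measurable_const
  refine measurable_of_tendsto_metrizable hF ?_
  rw [tendsto_pi_nhds]
  intro z
  by_cases h : Graftable β z.1 z.2
  · exact (tendsto_graftMap_trunc hβ h).congr fun n => (if_pos h).symm
  · rw [graftMap_of_not_graftable h]
    exact tendsto_const_nhds.congr fun n => (if_neg h).symm

open TreeSpace GenString

/-! ### Pointwise bounds in `p`-th powers -/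

section Pointwise

variable {β p : ℝ} {s : GenString} {τ τ' : ℕ → TreeSpace}

theorem edist_point (t : TreeSpace) : edist t point = ENNReal.ofReal (height t) := by
  rw [edist_dist, dist_point]

theorem ofReal_mass_mul_rpow (hp : 0 < p) (s : GenString) (i : ℕ) (d : ℝ) :
    ENNReal.ofReal (s.mass i ^ β * d) ^ p =
      ENNReal.ofReal (s.mass i ^ (p * β)) * ENNReal.ofReal d ^ p := by
  have h := s.mass_nonneg i
  rw [ENNReal.ofReal_mul (Real.rpow_nonneg h β), ENNReal.mul_rpow_of_nonneg _ _ hp.le,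
    ENNReal.ofReal_rpow_of_nonneg (Real.rpow_nonneg h β) hp.le, ← Real.rpow_mul h, mul_comm β]

/-- If the terms are bounded through a sum of `p`-th powers, they are bounded by its root. -/
theorem mass_mul_le (hp : 0 < p) {d : ℕ → ℝ}
    (hS : ∑' i, ENNReal.ofReal (s.mass i ^ (p * β)) * ENNReal.ofReal (d i) ^ p ≠ ∞) (i : ℕ) :
    s.mass i ^ β * d i ≤
      ((∑' i, ENNReal.ofReal (s.mass i ^ (p * β)) * ENNReal.ofReal (d i) ^ p) ^ p⁻¹).toReal := by
  rw [← ENNReal.ofReal_le_iff_le_toReal (ENNReal.rpow_ne_top_of_nonneg (by positivity) hS),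
    ENNReal.le_rpow_inv_iff hp, ofReal_mass_mul_rpow hp s i]
  exact ENNReal.le_tsum (f := fun i => ENNReal.ofReal (s.mass i ^ (p * β)) *
    ENNReal.ofReal (d i) ^ p) i

/-- Each rescaled distance is at most the `ℓ^p` norm of all of them, so that norm is an admissible
bound in `dist_graftMap_le_of_forall`. -/
theorem edist_graftMap_rpow_le (hp : 0 < p) (h : Graftable β s τ) (h' : Graftable β s τ') :
    edist (graftMap β s τ) (graftMap β s τ') ^ p ≤
      ∑' i, ENNReal.ofReal (s.mass i ^ (p * β)) * edist (τ i) (τ' i) ^ p := by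
  simp only [edist_dist]
  by_cases hS : ∑' i, ENNReal.ofReal (s.mass i ^ (p * β)) * ENNReal.ofReal (dist (τ i) (τ' i)) ^ p = ∞
  · rw [hS]
    exact le_top
  · rw [← ENNReal.le_rpow_inv_iff hp,
      ENNReal.ofReal_le_iff_le_toReal (ENNReal.rpow_ne_top_of_nonneg (by positivity) hS)]
    exact dist_graftMap_le_of_forall h h' ENNReal.toReal_nonneg
      (mass_mul_le hp hS)

theorem graftable_of_tsum_ne_top (hp : 0 < p)
    (hS : ∑' i, ENNReal.ofReal (s.mass i ^ (p * β)) * edist (τ i) point ^ p ≠ ∞) :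
    Graftable β s τ := by
  simp only [edist_point, ← ofReal_mass_mul_rpow hp s _ _] at hS
  have h1 := (ENNReal.tendsto_atTop_zero_of_tsum_ne_top hS).ennrpow_const p⁻¹
  simp only [ENNReal.rpow_rpow_inv hp.ne', ENNReal.zero_rpow_of_pos (inv_pos.2 hp)] at h1
  have h2 := (ENNReal.tendsto_toReal ENNReal.zero_ne_top).comp h1
  refine h2.congr fun i => ENNReal.toReal_ofReal ?_
  exact mul_nonneg (Graft.factor_nonneg β s i) (height_nonneg _)

theorem edist_graftMap_point_le (hp : 0 < p) (h : Graftable β s τ) :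
    edist (graftMap β s τ) point ≤ ENNReal.ofReal s.len +
      (∑' i, ENNReal.ofReal (s.mass i ^ (p * β)) * edist (τ i) point ^ p) ^ p⁻¹ := by
  simp only [edist_point]
  by_cases hS : ∑' i, ENNReal.ofReal (s.mass i ^ (p * β)) * ENNReal.ofReal (height (τ i)) ^ p = ∞
  · rw [hS, ENNReal.top_rpow_of_pos (by positivity), add_top]
    exact le_top
  · have hS' := ENNReal.rpow_ne_top_of_nonneg (y := p⁻¹) (by positivity) hS
    rw [← ENNReal.ofReal_toReal hS', ← ENNReal.ofReal_add s.len_nonneg ENNReal.toReal_nonneg]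
    exact ENNReal.ofReal_le_ofReal (height_graftMap_le h ENNReal.toReal_nonneg
      (mass_mul_le hp hS))

end Pointwise

/-! ### Minkowski's inequality and couplings of small cost -/

section Minkowski

variable {α : Type*} [MeasurableSpace α] {μ : Measure α} {p : ℝ}

theorem lintegral_sum_rpow_le (hp : 1 ≤ p) {g : ℕ → α → ℝ≥0∞} (hg : ∀ k, Measurable (g k)) (n : ℕ) :
    (∫⁻ a, (∑ k ∈ Finset.range n, g k a) ^ p ∂μ) ^ (1 / p) ≤
      ∑ k ∈ Finset.range n, (∫⁻ a, g k a ^ p ∂μ) ^ (1 / p) := by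
  have hp0 : 0 < p := zero_lt_one.trans_le hp
  induction n with
  | zero => simp [hp0]
  | succ n ih =>
    simp only [Finset.sum_range_succ]
    exact (ENNReal.lintegral_Lp_add_le (f := fun a => ∑ k ∈ Finset.range n, g k a)
      (Finset.measurable_sum _ fun k _ => hg k).aemeasurable (hg n).aemeasurable hp).trans
      (add_le_add_left ih _)

/-- Minkowski's inequality for a series. -/
theorem lintegral_tsum_rpow_le (hp : 1 ≤ p) {g : ℕ → α → ℝ≥0∞} (hg : ∀ k, Measurable (g k)) :
    (∫⁻ a, (∑' k, g k a) ^ p ∂μ) ^ (1 / p) ≤ ∑' k, (∫⁻ a, g k a ^ p ∂μ) ^ (1 / p) := by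
  have hp0 : 0 < p := zero_lt_one.trans_le hp
  have h1 : Tendsto (fun n => ∫⁻ a, (∑ k ∈ Finset.range n, g k a) ^ p ∂μ) atTop
      (𝓝 (∫⁻ a, (∑' k, g k a) ^ p ∂μ)) := by
    refine lintegral_tendsto_of_tendsto_of_monotone
      (fun n => ((Finset.measurable_sum _ fun k _ => hg k).pow_const p).aemeasurable)
      (Eventually.of_forall fun a m n hmn => ?_)
      (Eventually.of_forall fun a => (ENNReal.tendsto_nat_tsum _).ennrpow_const p)
    exact ENNReal.rpow_le_rpow (Finset.sum_le_sum_of_subset (Finset.range_mono hmn)) hp0.le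
  exact le_of_tendsto' (h1.ennrpow_const (1 / p)) fun n =>
    (lintegral_sum_rpow_le hp hg n).trans (ENNReal.sum_le_tsum _)

end Minkowski

section Coupling

/-- Two laws with couplings of arbitrarily small cost are equal. -/
theorem eq_of_forall_coupling {p : ℝ} (hp : 0 < p) {X : Type*} [PseudoMetricSpace X]
    [SecondCountableTopology X] [MeasurableSpace X] [BorelSpace X] {η η' : Measure X}
    [IsProbabilityMeasure η] [IsProbabilityMeasure η']
    (H : ∀ ε > 0, ∃ π : Measure (X × X), π.map Prod.fst = η ∧ π.map Prod.snd = η' ∧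
      ∫⁻ z, edist z.1 z.2 ^ p ∂π < ε) : η = η' := by
  -- By Markov's inequality a cheap coupling rarely moves a point by `δ` or more, so `η A` is at
  -- most the `η'`-measure of the `δ`-thickening of `A`; then `δ → 0`.
  have key : ∀ {η η' : Measure X} [IsProbabilityMeasure η] [IsProbabilityMeasure η'],
      (∀ ε > 0, ∃ π : Measure (X × X), π.map Prod.fst = η ∧ π.map Prod.snd = η' ∧
        ∫⁻ z, edist z.1 z.2 ^ p ∂π < ε) → ∀ A, IsClosed A → η A ≤ η' A := by
    intro η η' _ _ H A hA
    have h1 : ∀ δ : ℝ, 0 < δ → η A ≤ η' (Metric.cthickening δ A) := by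
      intro δ hδ
      have hδp : ENNReal.ofReal δ ^ p ≠ 0 := by
        simp [ENNReal.rpow_eq_zero_iff, hδ]
      have hδt : ENNReal.ofReal δ ^ p ≠ ∞ := ENNReal.rpow_ne_top_of_nonneg hp.le ENNReal.ofReal_ne_top
      refine ENNReal.le_of_forall_pos_le_add fun ε hε _ => ?_
      obtain ⟨π, rfl, rfl, h3⟩ := H (ENNReal.ofReal δ ^ p * ε)
        (ENNReal.mul_pos hδp (by simpa using hε.ne'))
      have hm : Measurable fun z : X × X => edist z.1 z.2 ^ p := by fun_prop
      have h4 := mul_meas_ge_le_lintegral (μ := π) hm (ENNReal.ofReal δ ^ p)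
      have h5 : π {z | ENNReal.ofReal δ ^ p ≤ edist z.1 z.2 ^ p} ≤ ε :=
        (ENNReal.mul_le_mul_iff_right hδp hδt).1 (h4.trans h3.le)
      rw [Measure.map_apply measurable_fst hA.measurableSet,
        Measure.map_apply measurable_snd Metric.isClosed_cthickening.measurableSet]
      refine (measure_mono ?_).trans ((measure_union_le _ _).trans (add_le_add_right h5 _))
      rintro ⟨x, y⟩ hx
      by_cases hd : ENNReal.ofReal δ ^ p ≤ edist x y ^ p
      · exact Or.inr hd
      · left
        rw [ENNReal.rpow_le_rpow_iff hp, not_le] at hd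
        show Metric.infEDist y A ≤ ENNReal.ofReal δ
        exact (Metric.infEDist_le_edist_of_mem (show x ∈ A from hx)).trans
          (by rw [edist_comm]; exact hd.le)
    have h2 := (tendsto_measure_cthickening_of_isClosed (μ := η')
      ⟨1, one_pos, measure_ne_top _ _⟩ hA).mono_left (nhdsWithin_le_nhds (s := Ioi 0))
    exact ge_of_tendsto h2 (eventually_nhdsWithin_of_forall fun δ hδ => h1 δ hδ)
  have H' : ∀ ε > 0, ∃ π : Measure (X × X), π.map Prod.fst = η' ∧ π.map Prod.snd = η ∧
      ∫⁻ z, edist z.1 z.2 ^ p ∂π < ε := by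
    intro ε hε
    obtain ⟨π, h1, h2, h3⟩ := H ε hε
    refine ⟨π.map Prod.swap, ?_, ?_, ?_⟩
    · rw [Measure.map_map measurable_fst measurable_swap]
      exact h2
    · rw [Measure.map_map measurable_snd measurable_swap]
      exact h1
    · rw [lintegral_map (by fun_prop) measurable_swap]
      simpa only [Prod.fst_swap, Prod.snd_swap, edist_comm] using h3
  refine MeasureTheory.ext_of_generate_finite _ (BorelSpace.measurable_eq.trans
    borel_eq_generateFrom_isClosed) isPiSystem_isClosed
    (fun A hA => le_antisymm (key H A hA) (key H' A hA)) (by simp)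

end Coupling

open TreeSpace GenString

/-! ### One step of the recursion: contraction in the mean -/

section Step

variable {β p : ℝ} {ν : Measure GenString}

/-- The mean of the sum of the `p`-th powers of the scaling factors. -/
noncomputable def massMoment (β p : ℝ) (ν : Measure GenString) : ℝ≥0∞ :=
  ∫⁻ s, ∑' j, ENNReal.ofReal (s.mass j ^ (p * β)) ∂ν

variable {Y : Type*} [MeasurableSpace Y] {κ : Measure Y} [IsProbabilityMeasure κ]
  {f g : Y → TreeSpace}

theorem measurable_ofReal_mass (β p : ℝ) (i : ℕ) :
    Measurable fun s : GenString => ENNReal.ofReal (s.mass i ^ (p * β)) :=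
  ((measurable_mass i).pow_const _).ennreal_ofReal

theorem measurable_graftMap_comp (hβ : 0 < β) (hf : Measurable f) :
    Measurable fun z : GenString × (ℕ → Y) => graftMap β z.1 fun i => f (z.2 i) := by
  have h : Measurable fun z : GenString × (ℕ → Y) => (z.1, fun i => f (z.2 i)) :=
    measurable_fst.prodMk (measurable_pi_lambda _ fun i =>
      hf.comp ((measurable_pi_apply i).comp measurable_snd))
  exact (measurable_graftMap hβ).comp h

/-- The mass and the tree at one atom are independent, so each term of the series factorises. -/
theorem lintegral_tsum_mass_mul {h : Y → ℝ≥0∞} (hh : Measurable h) :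
    ∫⁻ z, ∑' i, ENNReal.ofReal (z.1.mass i ^ (p * β)) * h (z.2 i)
        ∂(ν.prod (Measure.infinitePi fun _ : ℕ => κ)) =
      massMoment β p ν * ∫⁻ y, h y ∂κ := by
  have hm : ∀ i, Measurable fun z : GenString × (ℕ → Y) =>
      ENNReal.ofReal (z.1.mass i ^ (p * β)) * h (z.2 i) := fun i =>
    ((measurable_ofReal_mass β p i).comp measurable_fst).mul
      (hh.comp ((measurable_pi_apply i).comp measurable_snd))
  rw [massMoment, lintegral_tsum fun i => (measurable_ofReal_mass β p i).aemeasurable,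
    ← ENNReal.tsum_mul_right, lintegral_tsum fun i => (hm i).aemeasurable]
  refine tsum_congr fun i => ?_
  rw [lintegral_prod_mul (f := fun s : GenString => ENNReal.ofReal (s.mass i ^ (p * β)))
    (g := fun z : ℕ → Y => h (z i)) (measurable_ofReal_mass β p i).aemeasurable
    (hh.comp (measurable_pi_apply i)).aemeasurable]
  congr 1
  exact (measurePreserving_eval_infinitePi (fun _ : ℕ => κ) i).lintegral_comp hh

theorem ae_graftable (hp : 0 < p) (hc : massMoment β p ν ≠ ∞) (hf : Measurable f)
    (hfin : ∫⁻ y, edist (f y) point ^ p ∂κ ≠ ∞) :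
    ∀ᵐ z ∂(ν.prod (Measure.infinitePi fun _ : ℕ => κ)), Graftable β z.1 fun i => f (z.2 i) := by
  have hm : Measurable fun y => edist (f y) point ^ p := (hf.edist measurable_const).pow_const p
  have h := lintegral_tsum_mass_mul (β := β) (p := p) (ν := ν) (κ := κ) hm
  have hmeas : Measurable fun z : GenString × (ℕ → Y) =>
      ∑' i, ENNReal.ofReal (z.1.mass i ^ (p * β)) * edist (f (z.2 i)) point ^ p :=
    Measurable.tsum fun i => ((measurable_ofReal_mass β p i).comp measurable_fst).mul
      (hm.comp ((measurable_pi_apply i).comp measurable_snd))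
  filter_upwards [ae_lt_top hmeas (h ▸ ENNReal.mul_ne_top hc hfin)] with z hz
  exact graftable_of_tsum_ne_top hp hz.ne

/-- Grafting contracts distances in the mean. -/
theorem lintegral_edist_graftMap_le (hp : 0 < p) (hc : massMoment β p ν ≠ ∞) (hf : Measurable f)
    (hg : Measurable g) (hfin : ∫⁻ y, edist (f y) point ^ p ∂κ ≠ ∞)
    (hgfin : ∫⁻ y, edist (g y) point ^ p ∂κ ≠ ∞) :
    ∫⁻ z, edist (graftMap β z.1 fun i => f (z.2 i)) (graftMap β z.1 fun i => g (z.2 i)) ^ p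
        ∂(ν.prod (Measure.infinitePi fun _ : ℕ => κ)) ≤
      massMoment β p ν * ∫⁻ y, edist (f y) (g y) ^ p ∂κ := by
  rw [← lintegral_tsum_mass_mul ((hf.edist hg).pow_const p)]
  refine lintegral_mono_ae ?_
  filter_upwards [ae_graftable hp hc hf hfin, ae_graftable hp hc hg hgfin] with z h1 h2
  exact edist_graftMap_rpow_le hp h1 h2

theorem lintegral_edist_graftMap_point_ne_top [SFinite ν] (hp : 1 ≤ p) (hc : massMoment β p ν ≠ ∞)
    (hL : ∫⁻ s, ENNReal.ofReal s.len ^ p ∂ν ≠ ∞) (hf : Measurable f)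
    (hfin : ∫⁻ y, edist (f y) point ^ p ∂κ ≠ ∞) :
    ∫⁻ z, edist (graftMap β z.1 fun i => f (z.2 i)) point ^ p
        ∂(ν.prod (Measure.infinitePi fun _ : ℕ => κ)) ≠ ∞ := by
  have hp0 : 0 < p := zero_lt_one.trans_le hp
  have hm : Measurable fun y => edist (f y) point ^ p := (hf.edist measurable_const).pow_const p
  have hlen : Measurable fun s : GenString => ENNReal.ofReal s.len ^ p :=
    measurable_len.ennreal_ofReal.pow_const p
  have hlen' : Measurable fun z : GenString × (ℕ → Y) => ENNReal.ofReal z.1.len ^ p :=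
    hlen.comp measurable_fst
  refine ne_top_of_le_ne_top (b := (2 : ℝ≥0∞) ^ (p - 1) * (∫⁻ s, ENNReal.ofReal s.len ^ p ∂ν +
    massMoment β p ν * ∫⁻ y, edist (f y) point ^ p ∂κ)) ?_ ?_
  · exact ENNReal.mul_ne_top (ENNReal.rpow_ne_top_of_nonneg (by linarith) ENNReal.ofNat_ne_top)
      (ENNReal.add_ne_top.2 ⟨hL, ENNReal.mul_ne_top hc hfin⟩)
  · rw [← lintegral_tsum_mass_mul hm,
      ← (measurePreserving_fst (μ := ν) (ν := Measure.infinitePi fun _ : ℕ => κ)).lintegral_comp hlen,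
      ← lintegral_add_left hlen',
      ← lintegral_const_mul' _ _ (ENNReal.rpow_ne_top_of_nonneg (by linarith) ENNReal.ofNat_ne_top)]
    refine lintegral_mono_ae ?_
    filter_upwards [ae_graftable hp0 hc hf hfin] with z hz
    refine (ENNReal.rpow_le_rpow (edist_graftMap_point_le hp0 hz) hp0.le).trans
      ((ENNReal.rpow_add_le_mul_rpow_add_rpow _ _ hp).trans_eq ?_)
    rw [ENNReal.rpow_inv_rpow hp0.ne']

/-- The law of the tree grafted from independent copies of `f`. -/
theorem map_graftMap [SFinite ν] (hβ : 0 < β) (hf : Measurable f) :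
    (ν.prod (Measure.infinitePi fun _ : ℕ => κ)).map
      (fun z => graftMap β z.1 fun i => f (z.2 i)) = graftLaw β ν (κ.map f) := by
  have hf' : Measurable fun (y : ℕ → Y) i => f (y i) :=
    measurable_pi_lambda _ fun i => hf.comp (measurable_pi_apply i)
  have : IsProbabilityMeasure (κ.map f) := Measure.isProbabilityMeasure_map hf.aemeasurable
  rw [graftLaw, ← Measure.infinitePi_map_pi (fun _ : ℕ => κ) (fun _ => hf)]
  conv_rhs => rw [← Measure.map_id (μ := ν)]
  rw [Measure.map_prod_map _ _ measurable_id hf', Measure.map_map (measurable_graftMap hβ)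
    (measurable_id.prodMap hf')]
  rfl

end Step

/-! ### The recursive tree of i.i.d. strings and its limit -/

section Recursion

/-- The string at the root and the families of strings above its atoms, for a family of strings
indexed by the vertices of the infinite tree. -/
def splitFamily (ω : List ℕ → GenString) : GenString × (ℕ → List ℕ → GenString) :=
  (ω [], fun i u => ω (i :: u))

/-- A word is empty or a letter followed by a word. The family is thus a root string with
independent families above its atoms, each distributed as the whole. The inverse `join` is checked
on boxes, and currying separates the letters. -/
theorem measurePreserving_splitFamily (ν : Measure GenString) [IsProbabilityMeasure ν] :
    MeasurePreserving splitFamily (Measure.infinitePi fun _ : List ℕ => ν)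
      (ν.prod (Measure.infinitePi fun _ : ℕ => Measure.infinitePi fun _ : List ℕ => ν)) := by
  classical
  have hs : Measurable splitFamily := (measurable_pi_apply _).prodMk
    (measurable_pi_lambda _ fun i => measurable_pi_lambda _ fun u => measurable_pi_apply _)
  refine ⟨hs, ?_⟩
  let join : GenString × (ℕ × List ℕ → GenString) → List ℕ → GenString := fun z u =>
    match u with
    | [] => z.1
    | i :: u => z.2 (i, u)
  have hj : Measurable join := by
    refine measurable_pi_lambda _ fun u => ?_
    rcases u with _ | ⟨i, u⟩
    · exact measurable_fst
    · exact (measurable_pi_apply (i, u)).comp measurable_snd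
  have hinj : Function.Injective fun q : ℕ × List ℕ => q.1 :: q.2 := by
    rintro ⟨i, u⟩ ⟨j, v⟩ h
    simpa using h
  have hlaw : (ν.prod (Measure.infinitePi fun _ : ℕ × List ℕ => ν)).map join =
      Measure.infinitePi fun _ : List ℕ => ν := by
    refine Measure.eq_infinitePi _ fun s t ht => ?_
    rw [Measure.map_apply hj (.pi s.countable_toSet fun _ _ => ht _)]
    have hpre : join ⁻¹' ((s : Set (List ℕ)).pi t) = (if [] ∈ s then t [] else univ) ×ˢ
        ((s.preimage (fun q : ℕ × List ℕ => q.1 :: q.2) hinj.injOn : Set (ℕ × List ℕ)).pi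
          fun q => t (q.1 :: q.2)) := by
      ext z
      simp only [mem_preimage, Set.mem_pi, mem_prod, Finset.coe_preimage, Finset.mem_coe]
      constructor
      · intro h
        refine ⟨?_, fun q hq => h _ hq⟩
        split_ifs with h0
        · exact h [] h0
        · trivial
      · rintro ⟨h0, h⟩ (_ | ⟨i, u⟩) hu
        · rw [if_pos hu] at h0
          exact h0
        · exact h (i, u) hu
    rw [hpre, Measure.prod_prod, Measure.infinitePi_pi _ fun q _ => ht _,
      Finset.prod_preimage' (fun q : ℕ × List ℕ => q.1 :: q.2) s hinj.injOn fun u => ν (t u),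
      ← Finset.prod_filter_mul_prod_filter_not s (fun u => u ∈ range fun q : ℕ × List ℕ => q.1 :: q.2),
      mul_comm]
    congr 1
    -- The words not of the form `i :: u` reduce to the empty word, which contributes the factor of
    -- the root string.
    have hf : s.filter (fun u => u ∉ range fun q : ℕ × List ℕ => q.1 :: q.2) =
        s.filter (fun u => u = []) := by
      refine Finset.filter_congr fun u _ => ?_
      rcases u with _ | ⟨i, u⟩ <;> simp
    rw [hf, Finset.prod_filter, Finset.prod_ite_eq']
    split_ifs <;> simp
  have hcurry := (Measure.infinitePi_map_curry fun (_ : ℕ) (_ : List ℕ) => ν)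
  have hcm : Measurable (MeasurableEquiv.curry ℕ (List ℕ) GenString) :=
    MeasurableEquiv.measurable _
  nth_rewrite 1 [← hlaw]
  rw [Measure.map_map hs hj, ← hcurry]
  have h := Measure.map_prod_map ν (Measure.infinitePi fun _ : ℕ × List ℕ => ν) measurable_id hcm
  rw [Measure.map_id] at h
  rw [h]
  rfl

/-- The trees of `n` generations, grown from a family of strings. -/
noncomputable def growTree (β : ℝ) : ℕ → (List ℕ → GenString) → TreeSpace
  | 0, _ => point
  | n + 1, ω => graftMap β (splitFamily ω).1 fun i => growTree β n ((splitFamily ω).2 i)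

end Recursion

open TreeSpace GenString

theorem measurable_edist_point_rpow (p : ℝ) : Measurable fun t : TreeSpace => edist t point ^ p :=
  (measurable_id.edist measurable_const).pow_const p

/-- A sequence of random variables whose successive `L^p` distances decay geometrically converges
in `L^p`. -/
theorem exists_limit_of_lintegral_edist_le {α X : Type*} [MeasurableSpace α] {μ : Measure α}
    [PseudoMetricSpace X] [CompleteSpace X] [SecondCountableTopology X] [MeasurableSpace X]
    [BorelSpace X] {p : ℝ} (hp : 1 ≤ p) {f : ℕ → α → X} (hf : ∀ n, Measurable (f n)) {c D : ℝ≥0∞}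
    (hc : c < 1) (hD : D ≠ ∞) (h : ∀ n, ∫⁻ a, edist (f n a) (f (n + 1) a) ^ p ∂μ ≤ c ^ n * D) :
    ∃ g : α → X, Measurable g ∧ (∀ n, ∫⁻ a, edist (f n a) (g a) ^ p ∂μ ≠ ∞) ∧
      Tendsto (fun n => ∫⁻ a, edist (f n a) (g a) ^ p ∂μ) atTop (𝓝 0) := by
  have hp0 : 0 < p := zero_lt_one.trans_le hp
  -- `r` is the decay rate of the $L^p$ norms of the increments. By Minkowski's inequality the
  -- increments from time `n` on have total norm at most `r ^ n * K`, with `K` from the geometric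
  -- series. So their sum is finite almost everywhere, and the sequence is Cauchy there.
  set r := c ^ (1 / p) with hr
  have hr1 : r < 1 := ENNReal.rpow_lt_one hc (by positivity)
  set K := (1 - r)⁻¹ * D ^ (1 / p) with hK
  have hKt : K ≠ ∞ := ENNReal.mul_ne_top (ENNReal.inv_ne_top.2 (tsub_pos_of_lt hr1).ne')
    (ENNReal.rpow_ne_top_of_nonneg (by positivity) hD)
  let d : ℕ → α → ℝ≥0∞ := fun n a => edist (f n a) (f (n + 1) a)
  have hd : ∀ n, Measurable (d n) := fun n => (hf n).edist (hf (n + 1))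
  have hsum : ∀ n, ∫⁻ a, (∑' k, d (n + k) a) ^ p ∂μ ≤ (r ^ n * K) ^ p := by
    intro n
    have h1 := lintegral_tsum_rpow_le (μ := μ) hp fun k => hd (n + k)
    have h2 : ∑' k, (∫⁻ a, d (n + k) a ^ p ∂μ) ^ (1 / p) ≤ r ^ n * K := by
      calc ∑' k, (∫⁻ a, d (n + k) a ^ p ∂μ) ^ (1 / p)
          ≤ ∑' k, r ^ n * D ^ (1 / p) * r ^ k := by
            refine ENNReal.tsum_le_tsum fun k => ?_
            refine (ENNReal.rpow_le_rpow (h (n + k)) (by positivity)).trans_eq ?_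
            rw [ENNReal.mul_rpow_of_nonneg _ _ (by positivity), ← ENNReal.rpow_natCast,
              ← ENNReal.rpow_mul, mul_comm _ (1 / p), ENNReal.rpow_mul, ENNReal.rpow_natCast, ← hr,
              pow_add]
            ring
        _ = r ^ n * K := by
            rw [ENNReal.tsum_mul_left, ENNReal.tsum_geometric, hK]
            ring
    have h3 := ENNReal.rpow_le_rpow (h1.trans h2) hp0.le
    rwa [one_div, ENNReal.rpow_inv_rpow hp0.ne'] at h3
  have hfin : ∀ n, (r ^ n * K) ^ p ≠ ∞ := fun n => ENNReal.rpow_ne_top_of_nonneg hp0.le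
    (ENNReal.mul_ne_top (ENNReal.pow_ne_top hr1.ne_top) hKt)
  have hae : ∀ᵐ a ∂μ, ∑' k, d k a ≠ ∞ := by
    have h0 := ne_top_of_le_ne_top (hfin 0) (hsum 0)
    simp only [zero_add] at h0
    filter_upwards [ae_lt_top ((Measurable.tsum fun k => hd k).pow_const p) h0] with a ha htop
    rw [htop, ENNReal.top_rpow_of_pos hp0] at ha
    exact lt_irrefl _ ha
  obtain ⟨g, hg, hlim⟩ := measurable_limit_of_tendsto_metrizable_ae (fun n => (hf n).aemeasurable)
    (hae.mono fun a ha => cauchySeq_tendsto_of_complete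
      (cauchySeq_of_edist_le_of_tsum_ne_top (fun n => d n a) (fun _ => le_rfl) ha))
  have hle : ∀ n, ∫⁻ a, edist (f n a) (g a) ^ p ∂μ ≤ (r ^ n * K) ^ p := fun n => by
    refine (lintegral_mono_ae ?_).trans (hsum n)
    filter_upwards [hlim] with a ha
    exact ENNReal.rpow_le_rpow
      (edist_le_tsum_of_edist_le_of_tendsto (fun n => d n a) (fun _ => le_rfl) ha n) hp0.le
  refine ⟨g, hg, fun n => ne_top_of_le_ne_top (hfin n) (hle n), ?_⟩
  have h0 : Tendsto (fun n => (r ^ n * K) ^ p) atTop (𝓝 0) := by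
    have h1 := ENNReal.Tendsto.mul_const (b := K)
      (ENNReal.tendsto_pow_atTop_nhds_zero_of_lt_one hr1) (Or.inr hKt)
    have h2 := h1.ennrpow_const p
    rwa [zero_mul, ENNReal.zero_rpow_of_pos hp0] at h2
  exact tendsto_of_tendsto_of_tendsto_of_le_of_le tendsto_const_nhds h0 (fun _ => zero_le) hle

section GrowTree

variable {β p : ℝ} {ν : Measure GenString} [IsProbabilityMeasure ν]

theorem measurable_growTree (hβ : 0 < β) (n : ℕ) : Measurable (growTree β n) := by
  induction n with
  | zero => exact measurable_const
  | succ n ih =>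
    -- The Dirac measure is arbitrary; only the measurability of `splitFamily` is taken from it.
    exact (measurable_graftMap_comp hβ ih).comp
      (measurePreserving_splitFamily (Measure.dirac ⟨0, 0, 0, by simp, by simp⟩)).measurable

theorem lintegral_growTree_ne_top (hβ : 0 < β) (hp : 1 ≤ p) (hc : massMoment β p ν ≠ ∞)
    (hL : ∫⁻ s, ENNReal.ofReal s.len ^ p ∂ν ≠ ∞) (n : ℕ) :
    ∫⁻ ω, edist (growTree β n ω) point ^ p ∂(Measure.infinitePi fun _ : List ℕ => ν) ≠ ∞ := by
  have hp0 : 0 < p := zero_lt_one.trans_le hp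
  induction n with
  | zero => simp [growTree, hp0]
  | succ n ih =>
    have hm : Measurable fun z : GenString × (ℕ → List ℕ → GenString) =>
        edist (graftMap β z.1 fun i => growTree β n (z.2 i)) point ^ p :=
      ((measurable_graftMap_comp hβ (measurable_growTree hβ n)).edist measurable_const).pow_const p
    exact ((measurePreserving_splitFamily ν).lintegral_comp hm).trans_ne
      (lintegral_edist_graftMap_point_ne_top hp hc hL (measurable_growTree hβ n) ih)

theorem lintegral_edist_splitFamily_le (hβ : 0 < β) (hp : 0 < p) (hc : massMoment β p ν ≠ ∞)
    {f g : (List ℕ → GenString) → TreeSpace} (hf : Measurable f) (hg : Measurable g)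
    (hfin : ∫⁻ ω, edist (f ω) point ^ p ∂(Measure.infinitePi fun _ : List ℕ => ν) ≠ ∞)
    (hgfin : ∫⁻ ω, edist (g ω) point ^ p ∂(Measure.infinitePi fun _ : List ℕ => ν) ≠ ∞) :
    ∫⁻ ω, edist (graftMap β (splitFamily ω).1 fun i => f ((splitFamily ω).2 i))
        (graftMap β (splitFamily ω).1 fun i => g ((splitFamily ω).2 i)) ^ p
        ∂(Measure.infinitePi fun _ : List ℕ => ν) ≤
      massMoment β p ν * ∫⁻ ω, edist (f ω) (g ω) ^ p ∂(Measure.infinitePi fun _ : List ℕ => ν) := by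
  have hm : Measurable fun z : GenString × (ℕ → List ℕ → GenString) =>
      edist (graftMap β z.1 fun i => f (z.2 i)) (graftMap β z.1 fun i => g (z.2 i)) ^ p :=
    ((measurable_graftMap_comp hβ hf).edist (measurable_graftMap_comp hβ hg)).pow_const p
  exact ((measurePreserving_splitFamily ν).lintegral_comp hm).trans_le
    (lintegral_edist_graftMap_le hp hc hf hg hfin hgfin)

/-- The law of the limit of the trees `growTree β n` is a fixpoint. -/
theorem exists_fixpoint (hβ : 0 < β) (hp : 1 ≤ p) (hc : massMoment β p ν < 1)
    (hL : ∫⁻ s, ENNReal.ofReal s.len ^ p ∂ν ≠ ∞) :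
    ∃ η : Measure TreeSpace, IsProbabilityMeasure η ∧ ∫⁻ t, edist t point ^ p ∂η ≠ ∞ ∧
      graftLaw β ν η = η := by
  have hp0 : 0 < p := zero_lt_one.trans_le hp
  have hm := measurable_growTree (β := β) hβ
  have hfin := lintegral_growTree_ne_top hβ hp hc.ne_top hL
  set μ := Measure.infinitePi fun _ : List ℕ => ν
  -- `growTree β 0` is the one-point tree, so the first increment is the height of `growTree β 1`.
  -- Each further generation grafts both trees on the same root string.
  have hdecay : ∀ n, ∫⁻ ω, edist (growTree β n ω) (growTree β (n + 1) ω) ^ p ∂μ ≤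
      massMoment β p ν ^ n * ∫⁻ ω, edist (growTree β 1 ω) point ^ p ∂μ := by
    intro n
    induction n with
    | zero =>
      rw [pow_zero, one_mul]
      exact le_of_eq (lintegral_congr fun ω => by rw [edist_comm]; rfl)
    | succ n ih =>
      rw [pow_succ', mul_assoc]
      exact (lintegral_edist_splitFamily_le hβ hp0 hc.ne_top (hm n) (hm (n + 1)) (hfin n)
        (hfin (n + 1))).trans (mul_le_mul_right ih _)
  obtain ⟨T, hT, hTfin, hTlim⟩ := exists_limit_of_lintegral_edist_le hp hm hc (hfin 1) hdecay
  have hT0 : ∫⁻ ω, edist (T ω) point ^ p ∂μ ≠ ∞ := by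
    have h : ∫⁻ ω, edist (T ω) point ^ p ∂μ = ∫⁻ ω, edist (growTree β 0 ω) (T ω) ^ p ∂μ :=
      lintegral_congr fun ω => by rw [edist_comm]; rfl
    rw [h]
    exact hTfin 0
  have hprob : IsProbabilityMeasure (μ.map T) := Measure.isProbabilityMeasure_map hT.aemeasurable
  refine ⟨μ.map T, hprob, ?_, ?_⟩
  · rw [lintegral_map (measurable_edist_point_rpow p) hT]
    exact hT0
  -- The limits above the atoms are grafted on the root string. The law of `U` is the image of the
  -- law of `T` under the map, so it remains to compare `U` with `T`.
  let U : (List ℕ → GenString) → TreeSpace := fun ω =>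
    graftMap β (splitFamily ω).1 fun i => T ((splitFamily ω).2 i)
  have hV := measurable_graftMap_comp (β := β) hβ hT
  have hsplit := measurePreserving_splitFamily ν
  have hU : Measurable U := hV.comp hsplit.measurable
  have hUlaw : μ.map U = graftLaw β ν (μ.map T) := by
    rw [← map_graftMap hβ hT, ← hsplit.map_eq, Measure.map_map hV hsplit.measurable]
    rfl
  have hzero : ∫⁻ ω, edist (U ω) (T ω) ^ p ∂μ = 0 := by
    -- `growTree β (n + 1)` lies between: it is grafted like `U`, with `growTree β n` in place of
    -- `T`, and it tends to `T`.
    have hle : ∀ n, ∫⁻ ω, edist (U ω) (T ω) ^ p ∂μ ≤ (2 : ℝ≥0∞) ^ (p - 1) *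
        (massMoment β p ν * ∫⁻ ω, edist (growTree β n ω) (T ω) ^ p ∂μ +
          ∫⁻ ω, edist (growTree β (n + 1) ω) (T ω) ^ p ∂μ) := by
      intro n
      have h2 : (2 : ℝ≥0∞) ^ (p - 1) ≠ ∞ :=
        ENNReal.rpow_ne_top_of_nonneg (by linarith) ENNReal.ofNat_ne_top
      have h3 := lintegral_edist_splitFamily_le hβ hp0 hc.ne_top hT (hm n) hT0 (hfin n)
      simp only [edist_comm (T _)] at h3
      refine le_trans ?_ (mul_le_mul_right (add_le_add_left h3 _) _)
      rw [← lintegral_add_right _ (((hm (n + 1)).edist hT).pow_const p),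
        ← lintegral_const_mul' _ _ h2]
      refine lintegral_mono fun ω => ?_
      exact (ENNReal.rpow_le_rpow (edist_triangle _ (growTree β (n + 1) ω) _) hp0.le).trans
        (ENNReal.rpow_add_le_mul_rpow_add_rpow _ _ hp)
    have hlim : Tendsto (fun n => (2 : ℝ≥0∞) ^ (p - 1) *
        (massMoment β p ν * ∫⁻ ω, edist (growTree β n ω) (T ω) ^ p ∂μ +
          ∫⁻ ω, edist (growTree β (n + 1) ω) (T ω) ^ p ∂μ)) atTop (𝓝 0) := by
      have h1 := ENNReal.Tendsto.const_mul (a := massMoment β p ν) hTlim (Or.inr hc.ne_top)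
      have h2 := ENNReal.Tendsto.const_mul (a := (2 : ℝ≥0∞) ^ (p - 1))
        (h1.add (hTlim.comp (tendsto_add_atTop_nat 1)))
        (Or.inr (ENNReal.rpow_ne_top_of_nonneg (by linarith) ENNReal.ofNat_ne_top))
      simpa using h2
    exact le_antisymm (ge_of_tendsto' hlim hle) zero_le
  have hprob' : IsProbabilityMeasure (graftLaw β ν (μ.map T)) :=
    hUlaw ▸ Measure.isProbabilityMeasure_map hU.aemeasurable
  -- The joint law of `U` and `T` is a coupling of cost 0, so points at distance 0 need not be
  -- identified.
  refine eq_of_forall_coupling hp0 fun ε hε => ⟨μ.map fun ω => (U ω, T ω), ?_, ?_, ?_⟩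
  · rw [Measure.map_map measurable_fst (hU.prodMk hT), ← hUlaw]
    rfl
  · rw [Measure.map_map measurable_snd (hU.prodMk hT)]
    rfl
  · rw [lintegral_map (by fun_prop) (hU.prodMk hT)]
    simpa only [hzero] using hε

end GrowTree

/-! ### Transport of couplings and the Wasserstein distance -/

section Coupling

variable {β p : ℝ} {ν : Measure GenString} [IsProbabilityMeasure ν]

theorem isProbabilityMeasure_graftLaw (hβ : 0 < β) (η : Measure TreeSpace)
    [IsProbabilityMeasure η] : IsProbabilityMeasure (graftLaw β ν η) :=
  Measure.isProbabilityMeasure_map (measurable_graftMap hβ).aemeasurable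

theorem lintegral_graftLaw_ne_top (hβ : 0 < β) (hp : 1 ≤ p) (hc : massMoment β p ν ≠ ∞)
    (hL : ∫⁻ s, ENNReal.ofReal s.len ^ p ∂ν ≠ ∞) {η : Measure TreeSpace} [IsProbabilityMeasure η]
    (hη : ∫⁻ t, edist t point ^ p ∂η ≠ ∞) : ∫⁻ t, edist t point ^ p ∂(graftLaw β ν η) ≠ ∞ := by
  rw [graftLaw, lintegral_map (measurable_edist_point_rpow p) (measurable_graftMap hβ)]
  have h := lintegral_edist_graftMap_point_ne_top (κ := η) (f := fun t => t) hp hc hL measurable_id hη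
  exact h

/-- I.i.d. pairs with law `π` are drawn, and both components are grafted on the same string. -/
theorem exists_coupling_graftLaw (hβ : 0 < β) (hp : 0 < p) (hc : massMoment β p ν ≠ ∞)
    {η η' : Measure TreeSpace} [IsProbabilityMeasure η] (hη : ∫⁻ t, edist t point ^ p ∂η ≠ ∞)
    (hη' : ∫⁻ t, edist t point ^ p ∂η' ≠ ∞) {π : Measure (TreeSpace × TreeSpace)}
    (h₁ : π.map Prod.fst = η) (h₂ : π.map Prod.snd = η') :
    ∃ π' : Measure (TreeSpace × TreeSpace), π'.map Prod.fst = graftLaw β ν η ∧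
      π'.map Prod.snd = graftLaw β ν η' ∧
      ∫⁻ z, edist z.1 z.2 ^ p ∂π' ≤ massMoment β p ν * ∫⁻ z, edist z.1 z.2 ^ p ∂π := by
  have hπ : IsProbabilityMeasure π := ⟨by
    rw [← preimage_univ (f := Prod.fst), ← Measure.map_apply measurable_fst .univ, h₁, measure_univ]⟩
  subst h₁ h₂
  have hm := measurable_edist_point_rpow p
  rw [lintegral_map hm measurable_fst] at hη
  rw [lintegral_map hm measurable_snd] at hη'
  have hF := measurable_graftMap_comp (β := β) hβ (measurable_fst (α := TreeSpace) (β := TreeSpace))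
  have hG := measurable_graftMap_comp (β := β) hβ (measurable_snd (α := TreeSpace) (β := TreeSpace))
  refine ⟨_, (Measure.map_map measurable_fst (hF.prodMk hG)).trans (map_graftMap hβ measurable_fst),
    (Measure.map_map measurable_snd (hF.prodMk hG)).trans (map_graftMap hβ measurable_snd), ?_⟩
  rw [lintegral_map (by fun_prop) (hF.prodMk hG)]
  exact lintegral_edist_graftMap_le hp hc measurable_fst measurable_snd hη hη'

theorem exists_coupling_ne_top (hp : 1 ≤ p) {η η' : Measure TreeSpace} [IsProbabilityMeasure η]
    [IsProbabilityMeasure η'] (hη : ∫⁻ t, edist t point ^ p ∂η ≠ ∞)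
    (hη' : ∫⁻ t, edist t point ^ p ∂η' ≠ ∞) :
    ∃ π : Measure (TreeSpace × TreeSpace), π.map Prod.fst = η ∧ π.map Prod.snd = η' ∧
      ∫⁻ z, edist z.1 z.2 ^ p ∂π ≠ ∞ := by
  have hp0 : 0 < p := zero_lt_one.trans_le hp
  have h2 : (2 : ℝ≥0∞) ^ (p - 1) ≠ ∞ :=
    ENNReal.rpow_ne_top_of_nonneg (by linarith) ENNReal.ofNat_ne_top
  have hm := measurable_edist_point_rpow p
  have hm1 : Measurable fun z : TreeSpace × TreeSpace => edist z.1 point ^ p := hm.comp measurable_fst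
  refine ⟨η.prod η', by simp, by simp, ?_⟩
  refine ne_top_of_le_ne_top (b := (2 : ℝ≥0∞) ^ (p - 1) *
    (∫⁻ t, edist t point ^ p ∂η + ∫⁻ t, edist t point ^ p ∂η'))
    (ENNReal.mul_ne_top h2 (ENNReal.add_ne_top.2 ⟨hη, hη'⟩)) ?_
  rw [← (measurePreserving_fst (μ := η) (ν := η')).lintegral_comp hm,
    ← (measurePreserving_snd (μ := η) (ν := η')).lintegral_comp hm,
    ← lintegral_add_left hm1, ← lintegral_const_mul' _ _ h2]
  refine lintegral_mono fun z => ?_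
  refine (ENNReal.rpow_le_rpow (edist_triangle_right z.1 z.2 point) hp0.le).trans
    (ENNReal.rpow_add_le_mul_rpow_add_rpow _ _ hp)

theorem ofReal_height_rpow (hp : 0 < p) (t : TreeSpace) :
    ENNReal.ofReal (t.height ^ p) = edist t point ^ p := by
  rw [edist_point, ENNReal.ofReal_rpow_of_nonneg (height_nonneg t) hp.le]

theorem wasserstein_le (hp : 0 < p) {η η' : Measure TreeSpace}
    {π : Measure (TreeSpace × TreeSpace)} (h₁ : π.map Prod.fst = η) (h₂ : π.map Prod.snd = η') :
    wasserstein p η η' ≤ (∫⁻ z, edist z.1 z.2 ^ p ∂π) ^ (1 / p) := by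
  refine ENNReal.rpow_le_rpow ((iInf_le _ ⟨π, h₁, h₂⟩).trans (lintegral_mono fun z => ?_))
    (by positivity)
  rw [edist_dist, ENNReal.ofReal_rpow_of_nonneg dist_nonneg hp.le]
  exact ENNReal.ofReal_le_ofReal
    (Real.rpow_le_rpow (ghDist_nonneg _ _) (ghDist_le_dist _ _) hp.le)

end Coupling

end RDE

/-! ### Fixpoint, uniqueness and convergence -/

theorem mainTheorem1 (β p : ℝ) (hβ : 0 < β) (hp : 1 ≤ p)
    {Ω : Type*} [MeasurableSpace Ω] (ℙ : Measure Ω) [IsProbabilityMeasure ℙ]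
    (ξ : Ω → RDE.GenString) (hξ : Measurable ξ)
    (hL : ∫⁻ ω, ENNReal.ofReal ((ξ ω).len ^ p) ∂ℙ < ∞)
    (hP : ∫⁻ ω, ∑' j, ENNReal.ofReal ((ξ ω).mass j ^ (p * β)) ∂ℙ < 1) :
    ∃ Φ : RDE.TreeLaw p → RDE.TreeLaw p,
      (∀ η : RDE.TreeLaw p, ((Φ η).1 : Measure RDE.TreeSpace)
        = RDE.graftLaw β (ℙ.map ξ) (η.1 : Measure RDE.TreeSpace)) ∧
      ∃ ηstar : RDE.TreeLaw p, Φ ηstar = ηstar ∧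
        (∀ η : RDE.TreeLaw p, Φ η = η → η = ηstar) ∧
        ∀ η : RDE.TreeLaw p, Tendsto (fun n : ℕ => RDE.wasserstein p
          ((Φ^[n] η).1 : Measure RDE.TreeSpace) (ηstar.1 : Measure RDE.TreeSpace))
          atTop (𝓝 0) := by
  have hp0 : 0 < p := zero_lt_one.trans_le hp
  have hν : IsProbabilityMeasure (ℙ.map ξ) := Measure.isProbabilityMeasure_map hξ.aemeasurable
  have hc : RDE.massMoment β p (ℙ.map ξ) < 1 := by
    rw [RDE.massMoment, lintegral_map (Measurable.tsum fun i => RDE.measurable_ofReal_mass β p i) hξ]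
    exact hP
  have hlen : ∫⁻ s, ENNReal.ofReal s.len ^ p ∂(ℙ.map ξ) ≠ ∞ := by
    rw [lintegral_map (RDE.GenString.measurable_len.ennreal_ofReal.pow_const p) hξ]
    simpa only [ENNReal.ofReal_rpow_of_nonneg (RDE.GenString.len_nonneg _) hp0.le] using hL.ne
  have hmom : ∀ η : RDE.TreeLaw p,
      ∫⁻ t, edist t RDE.TreeSpace.point ^ p ∂(η.1 : Measure RDE.TreeSpace) ≠ ∞ := fun η => by
    simpa only [RDE.ofReal_height_rpow hp0] using η.2.ne
  let mk : (η : Measure RDE.TreeSpace) → IsProbabilityMeasure η →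
      ∫⁻ t, edist t RDE.TreeSpace.point ^ p ∂η ≠ ∞ → RDE.TreeLaw p := fun η h h' =>
    ⟨⟨η, h⟩, (lintegral_congr (RDE.ofReal_height_rpow hp0)).trans_lt h'.lt_top⟩
  let Φ : RDE.TreeLaw p → RDE.TreeLaw p := fun η =>
    mk (RDE.graftLaw β (ℙ.map ξ) η.1) (RDE.isProbabilityMeasure_graftLaw hβ _)
      (RDE.lintegral_graftLaw_ne_top hβ hp hc.ne_top hlen (hmom η))
  obtain ⟨η₀, hη₀, hη₀fin, hfix⟩ := RDE.exists_fixpoint hβ hp hc hlen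
  have hΦfix : Φ (mk η₀ hη₀ hη₀fin) = mk η₀ hη₀ hη₀fin := Subtype.ext (Subtype.ext hfix)
  -- `K` is the cost of the independent coupling with the fixpoint law. Each iteration moves only
  -- the first marginal, as `η₀` is fixed, and multiplies the cost by at most the mass moment.
  have hcoup : ∀ η : RDE.TreeLaw p, ∃ K : ℝ≥0∞, K ≠ ∞ ∧ ∀ n,
      ∃ π : Measure (RDE.TreeSpace × RDE.TreeSpace),
        π.map Prod.fst = ((Φ^[n] η).1 : Measure RDE.TreeSpace) ∧ π.map Prod.snd = η₀ ∧
        ∫⁻ z, edist z.1 z.2 ^ p ∂π ≤ RDE.massMoment β p (ℙ.map ξ) ^ n * K := by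
    intro η
    obtain ⟨π₀, h1, h2, h3⟩ := RDE.exists_coupling_ne_top hp (hmom η) hη₀fin
    refine ⟨_, h3, fun n => ?_⟩
    induction n with
    | zero => exact ⟨π₀, h1, h2, by rw [pow_zero, one_mul]⟩
    | succ n ih =>
      obtain ⟨π, h1, h2, h3⟩ := ih
      obtain ⟨π', h1', h2', h3'⟩ := RDE.exists_coupling_graftLaw (ν := ℙ.map ξ) hβ hp0 hc.ne_top
        (hmom _) hη₀fin h1 h2
      refine ⟨π', ?_, h2'.trans hfix, h3'.trans ?_⟩
      · rw [h1', Function.iterate_succ_apply']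
        rfl
      · rw [pow_succ', mul_assoc]
        exact mul_le_mul_right h3 _
  have hdecay : ∀ K : ℝ≥0∞, K ≠ ∞ →
      Tendsto (fun n => RDE.massMoment β p (ℙ.map ξ) ^ n * K) atTop (𝓝 0) := fun K hK => by
    have := ENNReal.Tendsto.mul_const (b := K)
      (ENNReal.tendsto_pow_atTop_nhds_zero_of_lt_one hc) (Or.inr hK)
    rwa [zero_mul] at this
  refine ⟨Φ, fun _ => rfl, mk η₀ hη₀ hη₀fin, hΦfix, fun η hη => ?_, fun η => ?_⟩
  · obtain ⟨K, hK, hπ⟩ := hcoup η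
    have hη' : IsProbabilityMeasure (η.1 : Measure RDE.TreeSpace) := η.1.2
    -- For another fixpoint the first marginal does not move either, so these are couplings of the
    -- same two laws with cost tending to 0.
    have heq : (η.1 : Measure RDE.TreeSpace) = η₀ :=
      RDE.eq_of_forall_coupling hp0 fun ε hε => by
        obtain ⟨n, hn⟩ := ((hdecay K hK).eventually (gt_mem_nhds hε)).exists
        obtain ⟨π, h1, h2, h3⟩ := hπ n
        rw [Function.iterate_fixed hη] at h1
        exact ⟨π, h1, h2, h3.trans_lt hn⟩
    exact Subtype.ext (Subtype.ext heq)
  · obtain ⟨K, hK, hπ⟩ := hcoup η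
    have h0 := (hdecay K hK).ennrpow_const (1 / p)
    rw [ENNReal.zero_rpow_of_pos (by positivity)] at h0
    refine tendsto_of_tendsto_of_tendsto_of_le_of_le tendsto_const_nhds h0
      (fun _ => zero_le) fun n => ?_
    obtain ⟨π, h1, h2, h3⟩ := hπ n
    exact (RDE.wasserstein_le hp0 h1 h2).trans (ENNReal.rpow_le_rpow h3 (by positivity))
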